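/- Let $d\ge 2$. Call $x,y\in\mathbb Z^d$ neighbours, $x\sim y$, if $\|x-y\|_{\ell^1}=1$; for $V\subset\mathbb Z^d$ let $\partial V=\{x\in V:\exists\,y\sim x,\ y\notin V\}$ and $\mathring V=V\setminus\partial V$. The boundary sandpile $\mathrm{BS}(\mu_0,\kappa_0)$ with initial mass distribution $\mu_0:\mathbb Z^d\to[0,\infty)$ of finite support and boundary capacity $\kappa_0>0$ is the following process. Start with $V_0=\operatorname{supp}\mu_0$, the mass $\mu_0$, and $v_0=0$. At time $k$ a site $x$ is unstable if $x\in\partial V_k$ and $\mu_k(x)>\kappa_0$, or $x\in\mathring V_k$ and $\mu_k(x)>0$. Toppling an unstable site $x$ yields $V_{k+1}=V_k\cup\{y:y\sim x\}$, $\mu_{k+1}(x)=0$, $\mu_{k+1}(y)=\mu_k(y)+\frac1{2d}\mu_k(x)$ for $y\sim x$ and $\mu_{k+1}(y)=\mu_k(y)$ for all other $y$, and $v_{k+1}(x)=v_k(x)+\mu_k(x)$ and $v_{k+1}(y)=v_k(y)$ for $y\ne x$; toppling a stable site changes nothing. The odometer of $\mathrm{BS}(\mu_0,\kappa_0)$ is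 the function $u:\mathbb Z^d\to\mathbb R$ such that $v_k\to u$ pointwise as $k\to\infty$ for every toppling sequence in which each site of $\mathbb Z^d$ occurs infinitely often. Let $\delta_0$ be the unit mass at the origin and $|\cdot|$ the Euclidean norm. For every $r_0>0$ there is a constant $C=C(d,r_0)$ such that for every real $n>1$ the odometer $u_n$ of $\mathrm{BS}(n\delta_0,n^{1/d})$ exists and, for all $x,y\in\mathbb Z^d$ with $|x|,|y|>r_0n^{1/d}$, $$|u_n(x)-u_n(y)|\le C\,n^{1/d}\,|x-y|.$$ -/

import Mathlib

namespace BoundarySandpile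

/-- Lattice points `x`, `y` of `ℤ^d` are neighbours if their `ℓ¹`-distance is `1`. -/
def Neighbour {d : ℕ} (x y : Fin d → ℤ) : Prop :=
  ∑ i, |x i - y i| = 1

/-- The boundary of `V`: the points of `V` that have a neighbour outside `V`. -/
def boundary {d : ℕ} (V : Set (Fin d → ℤ)) : Set (Fin d → ℤ) :=
  {x | x ∈ V ∧ ∃ y, Neighbour y x ∧ y ∉ V}

/-- The interior of `V`: the points of `V` that are not on its boundary. -/
def interior {d : ℕ} (V : Set (Fin d → ℤ)) : Set (Fin d → ℤ) :=
  V \ boundary V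

/-- The state of the process at a given time: the set of visited sites, the distribution of mass,
and the odometer (the amount of mass emitted so far from each site). -/
structure State (d : ℕ) where
  visited : Set (Fin d → ℤ)
  mass : (Fin d → ℤ) → ℝ
  odo : (Fin d → ℤ) → ℝ

/-- The state at time `0` for the initial mass distribution `μ₀`. -/
def initialState {d : ℕ} (μ₀ : (Fin d → ℤ) → ℝ) : State d where
  visited := Function.support μ₀
  mass := μ₀
  odo := 0

/-- A site is unstable (for the boundary capacity `κ`) if it is a boundary point of the visited set
that carries mass more than `κ`, or an interior point that carries positive mass. -/
def Unstable {d : ℕ} (κ : ℝ) (S : State d) (x : Fin d → ℤ) : Prop :=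
  (x ∈ boundary S.visited ∧ κ < S.mass x) ∨ (x ∈ interior S.visited ∧ 0 < S.mass x)

open Classical in
/-- Toppling the site `x`. If `x` is unstable, all its mass is distributed equally among its `2d`
neighbours, these become visited, and the emitted mass is added to the odometer at `x`.
If `x` is stable, nothing happens. -/
noncomputable def topple {d : ℕ} (κ : ℝ) (S : State d) (x : Fin d → ℤ) : State d :=
  if Unstable κ S x then
    { visited := S.visited ∪ {y | Neighbour y x}
      mass := fun y =>
        if y = x then 0
        else if Neighbour y x then S.mass y + S.mass x / (2 * (d : ℝ))
        else S.mass y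
      odo := fun y => if y = x then S.odo y + S.mass x else S.odo y }
  else S

/-- The state of `BS(μ₀, κ)` after the first `k` topplings of the toppling sequence `T`. -/
noncomputable def process {d : ℕ} (μ₀ : (Fin d → ℤ) → ℝ) (κ : ℝ) (T : ℕ → Fin d → ℤ) :
    ℕ → State d
  | 0 => initialState μ₀
  | k + 1 => topple κ (process μ₀ κ T k) (T k)

/-- A toppling sequence is infinitive if every site of `ℤ^d` occurs in it infinitely often. -/
def Infinitive {d : ℕ} (T : ℕ → Fin d → ℤ) : Prop :=
  ∀ x, {k | T k = x}.Infinite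

/-- `u` is the odometer function of `BS(μ₀, κ)`: for every infinitive toppling sequence, the
odometers at time `k` converge pointwise to `u` as `k → ∞`. (Infinitive sequences exist since
`ℤ^d` is countable, so there is at most one such `u`.) -/
def IsOdometer {d : ℕ} (μ₀ : (Fin d → ℤ) → ℝ) (κ : ℝ) (u : (Fin d → ℤ) → ℝ) : Prop :=
  ∀ T : ℕ → Fin d → ℤ, Infinitive T →
    ∀ x, Filter.Tendsto (fun k => (process μ₀ κ T k).odo x) Filter.atTop (nhds (u x))

/-- The Euclidean norm of a lattice point. -/
noncomputable def euclNorm {d : ℕ} (x : Fin d → ℤ) : ℝ :=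
  ‖WithLp.toLp 2 (fun i => (x i : ℝ))‖

/-- The distribution `n δ₀`: mass `n` at the origin, and no mass elsewhere. -/
noncomputable def pointMass (d : ℕ) (n : ℝ) : (Fin d → ℤ) → ℝ :=
  Pi.single 0 n

end BoundarySandpile

namespace BoundarySandpile

open Filter Topology

/-! Write κ = n^{1/d}. The odometer is the least function that stabilizes the sandpile
(`Stable.odo_le`): every partial odometer lies below every stabilizing function, and the limit along
an infinitive sequence is itself stabilizing (`stable_of_tendsto`). So one stabilizing function
suffices for existence, and `exists_isOdometer` then shows that u solves a discrete free boundary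
problem: u = avg u at points other than the origin where u > 0, and avg u ≤ κ where u = 0.

The stabilizing function is a truncated, shifted copy of the fundamental solution, supported in a
ball of radius comparable to κ (`exists_stable_pointMass`). Since n = κ^d, it bounds u by a constant
times κ² outside any ball of radius comparable to κ about the origin.

The Lipschitz bound must hold across the free boundary. There it is elementary: if u(x) = 0, then u
≥ 0 and avg u(x) ≤ κ force every neighbouring value to be at most 2dκ. Bernstein's method carries
this inside: the squared difference in a fixed direction, times a cutoff, plus a multiple of u² is
subharmonic where u is harmonic, hence controlled by its values next to the free boundary and at the
edge of a ball of radius ρ (`bernstein_subharmonic`, `sq_step_sub_le`). With ρ comparable to κ and u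
= O(κ²), the differences are O(κ); summing them along a lattice path gives the claim. -/

/-- The `2d` unit steps of the lattice `ℤ^d`. -/
def step {d : ℕ} (j : Fin d × Bool) : Fin d → ℤ :=
  Pi.single j.1 (cond j.2 1 (-1))

/-- The mean of `u` over the neighbours of `x`. -/
noncomputable def avg {d : ℕ} (u : (Fin d → ℤ) → ℝ) (x : Fin d → ℤ) : ℝ :=
  (∑ j, u (x + step j)) / (2 * (d : ℝ))

/-! ### Unit steps and neighbour averages. -/

section Lattice

variable {d : ℕ}

lemma step_injective : Function.Injective (step (d := d)) := by
  rintro ⟨i, a⟩ ⟨j, b⟩ h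
  have hi := congrFun h i
  have hj := congrFun h j
  by_cases hij : i = j
  · subst hij
    cases a <;> cases b <;> simp [step] at hi ⊢
  · cases a <;> cases b <;> simp [step, hij] at hi

lemma neighbour_iff {x y : Fin d → ℤ} : Neighbour y x ↔ ∃ j, y = x + step j := by
  constructor
  · intro h
    have hne : ∃ i, y i - x i ≠ 0 := by
      by_contra! hc
      simp [Neighbour, hc] at h
    obtain ⟨i, hi⟩ := hne
    have hs : |y i - x i| + ∑ k ∈ Finset.univ.erase i, |y k - x k| = 1 := by
      rw [Finset.add_sum_erase _ (fun k => |y k - x k|) (Finset.mem_univ i)]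
      exact h
    have hpos : 1 ≤ |y i - x i| := Int.one_le_abs hi
    have hnn : 0 ≤ ∑ k ∈ Finset.univ.erase i, |y k - x k| :=
      Finset.sum_nonneg fun k _ => abs_nonneg _
    have hz : ∑ k ∈ Finset.univ.erase i, |y k - x k| = 0 := by omega
    have hi1 : |y i - x i| = 1 := by omega
    have hoff : ∀ k, k ≠ i → y k = x k := by
      intro k hk
      have := (Finset.sum_eq_zero_iff_of_nonneg fun k _ => abs_nonneg (y k - x k)).1 hz k
        (Finset.mem_erase.2 ⟨hk, Finset.mem_univ k⟩)
      have := abs_eq_zero.1 this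
      omega
    rcases (abs_eq (by norm_num : (0 : ℤ) ≤ 1)).1 hi1 with h1 | h1
    · refine ⟨(i, true), funext fun k => ?_⟩
      by_cases hk : k = i
      · subst hk; simp [step]; omega
      · simp [step, hk, hoff k hk]
    · refine ⟨(i, false), funext fun k => ?_⟩
      by_cases hk : k = i
      · subst hk; simp [step]; omega
      · simp [step, hk, hoff k hk]
  · rintro ⟨⟨i, b⟩, rfl⟩
    have : ∀ k, |(x + step (i, b)) k - x k| = if k = i then 1 else 0 := by
      intro k
      by_cases hk : k = i
      · subst hk; cases b <;> simp [step]
      · simp [step, hk]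
    unfold Neighbour
    simp only [this, Finset.sum_ite_eq', Finset.mem_univ, if_true]

lemma Neighbour.symm {x y : Fin d → ℤ} (h : Neighbour x y) : Neighbour y x := by
  unfold Neighbour at *
  simpa only [abs_sub_comm] using h

lemma not_neighbour_self (x : Fin d → ℤ) : ¬ Neighbour x x := by
  simp [Neighbour]

lemma neighbour_step (x : Fin d → ℤ) (j : Fin d × Bool) : Neighbour (x + step j) x :=
  neighbour_iff.2 ⟨j, rfl⟩

lemma avg_mono {u v : (Fin d → ℤ) → ℝ} (h : ∀ x, u x ≤ v x) (x : Fin d → ℤ) :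
    avg u x ≤ avg v x := by
  unfold avg
  gcongr
  exact h _

lemma tendsto_avg {v : ℕ → (Fin d → ℤ) → ℝ} {u : (Fin d → ℤ) → ℝ}
    (h : ∀ x, Tendsto (fun k => v k x) atTop (𝓝 (u x))) (x : Fin d → ℤ) :
    Tendsto (fun k => avg (v k) x) atTop (𝓝 (avg u x)) := by
  unfold avg
  exact (tendsto_finsetSum _ fun j _ => h _).div_const _

-- This is the effect of one toppling on the averaged odometer; it preserves the identity mass = μ₀
-- - odometer + avg odometer.
open Classical in
lemma avg_add_single (u : (Fin d → ℤ) → ℝ) (x y : Fin d → ℤ) (m : ℝ) :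
    avg (fun z => if z = x then u z + m else u z) y =
      avg u y + if Neighbour y x then m / (2 * (d : ℝ)) else 0 := by
  have h : ∑ j, (if y + step j = x then u (y + step j) + m else u (y + step j)) =
      ∑ j, u (y + step j) + if Neighbour y x then m else 0 := by
    have h1 : ∀ j : Fin d × Bool,
        (if y + step j = x then u (y + step j) + m else u (y + step j)) =
        u (y + step j) + if y + step j = x then m else 0 := by
      intro j; split_ifs <;> simp
    rw [Finset.sum_congr rfl fun j _ => h1 j, Finset.sum_add_distrib]
    congr 1
    split_ifs with hn
    · obtain ⟨j, hj⟩ := neighbour_iff.1 hn.symm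
      have h2 : ∀ k : Fin d × Bool, (y + step k = x) ↔ k = j := by
        intro k
        rw [hj, add_right_inj]
        exact step_injective.eq_iff
      simp [h2]
    · refine Finset.sum_eq_zero fun j _ => if_neg fun hj => hn ?_
      exact (hj ▸ neighbour_step y j).symm
  unfold avg
  rw [h, add_div]
  split_ifs <;> simp

end Lattice

/-! ### Least action principle and the discrete free boundary problem. -/

section Dynamics

variable {d : ℕ}

/-- The set of visited sites of a process with initial mass `μ₀` and odometer `w`. -/
def reach (μ₀ w : (Fin d → ℤ) → ℝ) : Set (Fin d → ℤ) :=
  Function.support μ₀ ∪ {y | ∃ x, Neighbour y x ∧ 0 < w x}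

lemma reach_mono {μ₀ v w : (Fin d → ℤ) → ℝ} (h : ∀ x, v x ≤ w x) : reach μ₀ v ⊆ reach μ₀ w := by
  rintro x (hx | ⟨y, hxy, hy⟩)
  · exact Or.inl hx
  · exact Or.inr ⟨y, hxy, hy.trans_le (h y)⟩

lemma mem_interior_iff {V : Set (Fin d → ℤ)} {x : Fin d → ℤ} :
    x ∈ interior V ↔ x ∈ V ∧ ∀ y, Neighbour y x → y ∈ V := by
  unfold interior boundary
  simp only [Set.mem_sdiff, Set.mem_ofPred_eq]
  constructor
  · rintro ⟨h1, h2⟩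
    refine ⟨h1, fun y hy => ?_⟩
    by_contra hc
    exact h2 ⟨h1, y, hy, hc⟩
  · rintro ⟨h1, h2⟩
    exact ⟨h1, fun ⟨_, y, hy, hc⟩ => hc (h2 y hy)⟩

lemma mem_boundary_iff {V : Set (Fin d → ℤ)} {x : Fin d → ℤ} :
    x ∈ boundary V ↔ x ∈ V ∧ x ∉ interior V := by
  unfold interior
  constructor
  · intro h
    exact ⟨h.1, fun h' => h'.2 h⟩
  · rintro ⟨h1, h2⟩
    by_contra hc
    exact h2 ⟨h1, hc⟩

lemma interior_mono {V W : Set (Fin d → ℤ)} (h : V ⊆ W) : interior V ⊆ interior W := by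
  intro x hx
  rw [mem_interior_iff] at hx ⊢
  exact ⟨h hx.1, fun y hy => h (hx.2 y hy)⟩

/-- The relations between the components of the state that are preserved by toppling. -/
structure Consistent (μ₀ : (Fin d → ℤ) → ℝ) (S : State d) : Prop where
  mass_nonneg : ∀ x, 0 ≤ S.mass x
  odo_nonneg : ∀ x, 0 ≤ S.odo x
  mass_eq : ∀ x, S.mass x = μ₀ x - S.odo x + avg S.odo x
  visited_eq : S.visited = reach μ₀ S.odo
  odo_pos : ∀ x, 0 < S.odo x → x ∈ S.visited

lemma Consistent.mem_interior {μ₀ : (Fin d → ℤ) → ℝ} {S : State d} (h : Consistent μ₀ S)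
    {x : Fin d → ℤ} (hx : 0 < S.odo x) : x ∈ interior S.visited := by
  rw [mem_interior_iff]
  refine ⟨h.odo_pos x hx, fun y hy => ?_⟩
  rw [h.visited_eq]
  exact Or.inr ⟨x, hy, hx⟩

lemma consistent_initialState {μ₀ : (Fin d → ℤ) → ℝ} (h : ∀ x, 0 ≤ μ₀ x) :
    Consistent μ₀ (initialState μ₀) where
  mass_nonneg := h
  odo_nonneg x := le_rfl
  mass_eq x := by simp [initialState, avg]
  visited_eq := by simp [initialState, reach]
  odo_pos x hx := absurd hx (lt_irrefl _)

lemma Unstable.mem_visited {κ : ℝ} {S : State d} {x : Fin d → ℤ} (h : Unstable κ S x) :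
    x ∈ S.visited := by
  rcases h with h | h
  · exact h.1.1
  · exact h.1.1

lemma Unstable.mass_pos {κ : ℝ} (hκ : 0 < κ) {S : State d} {x : Fin d → ℤ} (h : Unstable κ S x) :
    0 < S.mass x := by
  rcases h with h | h
  · exact hκ.trans h.2
  · exact h.2

open Classical in
lemma odo_topple (κ : ℝ) (S : State d) {x : Fin d → ℤ} (h : Unstable κ S x) (y : Fin d → ℤ) :
    (topple κ S x).odo y = if y = x then S.odo y + S.mass x else S.odo y := by
  simp [topple, h]

lemma odo_le_odo_topple {κ : ℝ} (hκ : 0 < κ) (S : State d) (x y : Fin d → ℤ) :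
    S.odo y ≤ (topple κ S x).odo y := by
  classical
  by_cases h : Unstable κ S x
  · rw [odo_topple κ S h]
    have := h.mass_pos hκ
    split_ifs <;> linarith
  · simp [topple, h]

lemma Consistent.topple {κ : ℝ} (hκ : 0 < κ) {μ₀ : (Fin d → ℤ) → ℝ} {S : State d}
    (h : Consistent μ₀ S) (x : Fin d → ℤ) : Consistent μ₀ (topple κ S x) := by
  classical
  by_cases hu : Unstable κ S x
  swap
  · simpa [BoundarySandpile.topple, hu] using h
  have hm := hu.mass_pos hκ
  have hodo := odo_topple κ S hu
  have hvis : (BoundarySandpile.topple κ S x).visited = S.visited ∪ {y | Neighbour y x} := by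
    simp [BoundarySandpile.topple, hu]
  have hmass : ∀ y, (BoundarySandpile.topple κ S x).mass y = if y = x then 0
      else if Neighbour y x then S.mass y + S.mass x / (2 * (d : ℝ)) else S.mass y := by
    simp [BoundarySandpile.topple, hu]
  have hpos : ∀ y, 0 < (BoundarySandpile.topple κ S x).odo y ↔ 0 < S.odo y ∨ y = x := by
    intro y
    rw [hodo]
    have := h.odo_nonneg y
    split_ifs with hy
    · exact ⟨fun _ => Or.inr hy, fun _ => by linarith⟩
    · simp [hy]
  refine ⟨fun y => ?_, fun y => ?_, fun y => ?_, ?_, fun y hy => ?_⟩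
  · rw [hmass]
    have := h.mass_nonneg y
    split_ifs
    · exact le_rfl
    · positivity
    · assumption
  · exact (h.odo_nonneg y).trans (odo_le_odo_topple hκ S x y)
  · have h1 := avg_add_single S.odo x y (S.mass x)
    rw [← funext hodo] at h1
    rw [h1, hmass, hodo, h.mass_eq y]
    by_cases hy : y = x
    · subst hy
      rw [if_pos rfl, if_pos rfl, if_neg (not_neighbour_self y), h.mass_eq y]
      ring
    · rw [if_neg hy, if_neg hy]
      split_ifs <;> ring
  · rw [hvis, h.visited_eq]
    ext y
    simp only [reach, Set.mem_union, Set.mem_ofPred_eq, hpos]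
    constructor
    · rintro ((h1 | ⟨z, hz, hz'⟩) | h1)
      · exact Or.inl h1
      · exact Or.inr ⟨z, hz, Or.inl hz'⟩
      · exact Or.inr ⟨x, h1, Or.inr rfl⟩
    · rintro (h1 | ⟨z, hz, hz' | rfl⟩)
      · exact Or.inl (Or.inl h1)
      · exact Or.inl (Or.inr ⟨z, hz, hz'⟩)
      · exact Or.inr hz
  · rw [hvis]
    rcases (hpos y).1 hy with h1 | rfl
    · exact Or.inl (h.odo_pos y h1)
    · exact Or.inl hu.mem_visited

lemma consistent_process {κ : ℝ} (hκ : 0 < κ) {μ₀ : (Fin d → ℤ) → ℝ} (h : ∀ x, 0 ≤ μ₀ x)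
    (T : ℕ → Fin d → ℤ) (k : ℕ) : Consistent μ₀ (process μ₀ κ T k) := by
  induction k with
  | zero => exact consistent_initialState h
  | succ k ih => exact ih.topple hκ _

/-- `w` is a nonnegative function for which the configuration `μ₀ - w + avg w` is stable. -/
structure Stable (μ₀ : (Fin d → ℤ) → ℝ) (κ : ℝ) (w : (Fin d → ℤ) → ℝ) : Prop where
  nonneg : ∀ x, 0 ≤ w x
  pos_mem : ∀ x, 0 < w x → x ∈ reach μ₀ w
  of_interior : ∀ x ∈ interior (reach μ₀ w), μ₀ x + avg w x ≤ w x
  of_boundary : ∀ x ∈ boundary (reach μ₀ w), μ₀ x + avg w x ≤ κ + w x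

lemma Stable.mem_interior {μ₀ : (Fin d → ℤ) → ℝ} {κ : ℝ} {w : (Fin d → ℤ) → ℝ}
    (h : Stable μ₀ κ w) {x : Fin d → ℤ} (hx : 0 < w x) : x ∈ interior (reach μ₀ w) := by
  rw [mem_interior_iff]
  exact ⟨h.pos_mem x hx, fun y hy => Or.inr ⟨x, hy, hx⟩⟩

/-- The least action principle. -/
lemma Stable.odo_le {μ₀ : (Fin d → ℤ) → ℝ} {κ : ℝ} {w : (Fin d → ℤ) → ℝ}
    (h : Stable μ₀ κ w) (hκ : 0 < κ) (hμ : ∀ x, 0 ≤ μ₀ x) (T : ℕ → Fin d → ℤ) (k : ℕ) :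
    ∀ x, (process μ₀ κ T k).odo x ≤ w x := by
  classical
  induction k with
  | zero => exact h.nonneg
  | succ k ih =>
    intro y
    have hc := consistent_process hκ hμ T k
    change (topple κ (process μ₀ κ T k) (T k)).odo y ≤ w y
    by_cases hu : Unstable κ (process μ₀ κ T k) (T k)
    swap
    · simpa [topple, hu] using ih y
    rw [odo_topple _ _ hu]
    split_ifs with hy
    swap
    · exact ih y
    rw [← hy] at hu ⊢
    have hsub : (process μ₀ κ T k).visited ⊆ reach μ₀ w := by
      rw [hc.visited_eq]
      exact reach_mono ih
    have havg := avg_mono ih y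
    have hmass := hc.mass_eq y
    -- After toppling, the odometer at `y` equals μ₀ + avg of the old odometer, hence is at most μ₀
    -- + avg w. At interior points this is at most w.
    by_cases hint : y ∈ interior (reach μ₀ w)
    · have := h.of_interior y hint
      linarith
    -- Elsewhere w vanishes, so `y` has not emitted mass, and its mass is at most μ₀ + avg w ≤ κ: it
    -- cannot be unstable as a boundary site. Nor can it be interior to the smaller visited set.
    · exfalso
      rcases hu with hu | hu
      · have h1 := h.of_boundary y (mem_boundary_iff.2 ⟨hsub hu.1.1, hint⟩)
        have h2 : w y = 0 := by
          by_contra h0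
          exact hint (h.mem_interior (lt_of_le_of_ne (h.nonneg y) (Ne.symm h0)))
        have h3 := hc.odo_nonneg y
        linarith [hu.2]
      · exact hint (interior_mono hsub hu.1)

lemma monotone_odo_process {κ : ℝ} (hκ : 0 < κ) (μ₀ : (Fin d → ℤ) → ℝ)
    (T : ℕ → Fin d → ℤ) (x : Fin d → ℤ) : Monotone fun k => (process μ₀ κ T k).odo x :=
  monotone_nat_of_le_succ fun k => odo_le_odo_topple hκ (process μ₀ κ T k) (T k) x

lemma exists_tendsto_odo {μ₀ : (Fin d → ℤ) → ℝ} {κ : ℝ} {w : (Fin d → ℤ) → ℝ}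
    (h : Stable μ₀ κ w) (hκ : 0 < κ) (hμ : ∀ x, 0 ≤ μ₀ x) (T : ℕ → Fin d → ℤ) :
    ∃ u : (Fin d → ℤ) → ℝ, (∀ x, u x ≤ w x) ∧
      ∀ x, Tendsto (fun k => (process μ₀ κ T k).odo x) atTop (𝓝 (u x)) := by
  have hb : ∀ x, BddAbove (Set.range fun k => (process μ₀ κ T k).odo x) := fun x =>
    ⟨w x, by rintro _ ⟨k, rfl⟩; exact h.odo_le hκ hμ T k x⟩
  refine ⟨fun x => ⨆ k, (process μ₀ κ T k).odo x, fun x => ciSup_le fun k => h.odo_le hκ hμ T k x,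
    fun x => tendsto_atTop_ciSup (monotone_odo_process hκ μ₀ T x) (hb x)⟩

/-- The limiting odometer of an infinitive toppling sequence stabilizes the sandpile. -/
lemma stable_of_tendsto {μ₀ : (Fin d → ℤ) → ℝ} {κ : ℝ} (hκ : 0 < κ) (hμ : ∀ x, 0 ≤ μ₀ x)
    {T : ℕ → Fin d → ℤ} (hT : Infinitive T) {u : (Fin d → ℤ) → ℝ}
    (hu : ∀ x, Tendsto (fun k => (process μ₀ κ T k).odo x) atTop (𝓝 (u x))) :
    Stable μ₀ κ u := by
  have hc := consistent_process hκ hμ T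
  have hmono := monotone_odo_process hκ μ₀ T
  have hle : ∀ k x, (process μ₀ κ T k).odo x ≤ u x := fun k x => (hmono x).ge_of_tendsto (hu x) k
  have hsub : ∀ k, (process μ₀ κ T k).visited ⊆ reach μ₀ u := fun k => by
    rw [(hc k).visited_eq]
    exact reach_mono (hle k)
  have hev : ∀ x, 0 < u x → ∀ᶠ k in atTop, 0 < (process μ₀ κ T k).odo x := fun x hx =>
    (hu x).eventually (lt_mem_nhds hx)
  have hvis : ∀ x ∈ reach μ₀ u, ∀ᶠ k in atTop, x ∈ (process μ₀ κ T k).visited := by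
    rintro x (hx | ⟨y, hxy, hy⟩)
    · refine Eventually.of_forall fun k => ?_
      rw [(hc k).visited_eq]
      exact Or.inl hx
    · filter_upwards [hev y hy] with k hk
      rw [(hc k).visited_eq]
      exact Or.inr ⟨y, hxy, hk⟩
  have hint : ∀ x ∈ interior (reach μ₀ u),
      ∀ᶠ k in atTop, x ∈ interior (process μ₀ κ T k).visited := by
    intro x hx
    rw [mem_interior_iff] at hx
    have h1 : ∀ᶠ k in atTop, ∀ j, x + step j ∈ (process μ₀ κ T k).visited :=
      eventually_all.2 fun j => hvis _ (hx.2 _ (neighbour_step x j))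
    filter_upwards [h1, hvis x hx.1] with k hk hk'
    rw [mem_interior_iff]
    refine ⟨hk', fun y hy => ?_⟩
    obtain ⟨j, rfl⟩ := neighbour_iff.1 hy
    exact hk j
  have hfreq : ∀ x, ∃ᶠ k in atTop, T k = x := fun x => Nat.frequently_atTop_iff_infinite.2 (hT x)
  have hpos : ∀ x, 0 < u x → x ∈ reach μ₀ u := by
    intro x hx
    obtain ⟨k, hk⟩ := (hev x hx).exists
    exact hsub k ((hc k).odo_pos x hk)
  have hlim : ∀ x, Tendsto (fun k => μ₀ x + avg (process μ₀ κ T k).odo x) atTop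
      (𝓝 (μ₀ x + avg u x)) := fun x => (tendsto_avg hu x).const_add _
  refine ⟨fun x => ((hc 0).odo_nonneg x).trans (hle 0 x), hpos, fun x hx => ?_, fun x hx => ?_⟩
  -- The inequality is checked only at the infinitely many times when `x` is toppled, and the
  -- odometer is read one step later, after its mass has been emitted.
  · refine le_of_tendsto_of_tendsto_of_frequently (hlim x) ((tendsto_add_atTop_iff_nat 1).2 (hu x))
      (((hfreq x).and_eventually (hint x hx)).mono ?_)
    rintro k ⟨hk, hki⟩
    have hm := (hc k).mass_eq x
    change _ ≤ (topple κ (process μ₀ κ T k) (T k)).odo x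
    rw [hk]
    by_cases hun : Unstable κ (process μ₀ κ T k) x
    · rw [odo_topple _ _ hun, if_pos rfl]
      linarith
    · have h1 : (process μ₀ κ T k).mass x ≤ 0 := by
        by_contra! h0
        exact hun (Or.inr ⟨hki, h0⟩)
      have h2 := odo_le_odo_topple hκ (process μ₀ κ T k) x x
      linarith
  · rw [mem_boundary_iff] at hx
    have hux : u x ≤ 0 := by
      by_contra! h0
      refine hx.2 ?_
      rw [mem_interior_iff]
      exact ⟨hx.1, fun y hy => Or.inr ⟨x, hy, h0⟩⟩
    refine le_of_tendsto_of_tendsto_of_frequently (hlim x) ((hu x).const_add κ)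
      (((hfreq x).and_eventually (hvis x hx.1)).mono ?_)
    rintro k ⟨hk, hkv⟩
    have hm := (hc k).mass_eq x
    have hkb : x ∈ boundary (process μ₀ κ T k).visited :=
      mem_boundary_iff.2 ⟨hkv, fun h => hx.2 (interior_mono (hsub k) h)⟩
    -- Otherwise `x` would topple and acquire a positive odometer, although `u x ≤ 0`.
    by_contra! h0
    have hun : Unstable κ (process μ₀ κ T k) x := Or.inl ⟨hkb, by linarith⟩
    have h1 : (process μ₀ κ T (k + 1)).odo x =
        (process μ₀ κ T k).odo x + (process μ₀ κ T k).mass x := by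
      change (topple κ (process μ₀ κ T k) (T k)).odo x = _
      rw [hk, odo_topple _ _ hun, if_pos rfl]
    have h2 := hle (k + 1) x
    have h3 := hun.mass_pos hκ
    have h4 := (hc k).odo_nonneg x
    linarith

lemma exists_infinitive (d : ℕ) : ∃ T : ℕ → Fin d → ℤ, Infinitive T := by
  obtain ⟨f, hf⟩ := exists_surjective_nat (Fin d → ℤ)
  refine ⟨fun k => f k.unpair.1, fun x => ?_⟩
  obtain ⟨a, rfl⟩ := hf x
  refine Set.infinite_of_injective_forall_mem (f := fun b => Nat.pair a b) ?_ fun b => ?_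
  · intro b c h
    simpa using h
  · simp

/-- If some function stabilizes the sandpile, then the odometer exists, is at most this function,
and solves the discrete free boundary problem. -/
theorem exists_isOdometer {μ₀ : (Fin d → ℤ) → ℝ} {κ : ℝ} (hκ : 0 < κ) (hμ : ∀ x, 0 ≤ μ₀ x)
    {w : (Fin d → ℤ) → ℝ} (hw : Stable μ₀ κ w) :
    ∃ u : (Fin d → ℤ) → ℝ, IsOdometer μ₀ κ u ∧ (∀ x, 0 ≤ u x) ∧ (∀ x, u x ≤ w x) ∧
      (∀ x, 0 < u x → u x = μ₀ x + avg u x) ∧ ∀ x, u x = 0 → avg u x ≤ κ := by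
  obtain ⟨T, hT⟩ := exists_infinitive d
  obtain ⟨u, huw, hu⟩ := exists_tendsto_odo hw hκ hμ T
  have hs := stable_of_tendsto hκ hμ hT hu
  refine ⟨u, fun T' hT' x => ?_, hs.nonneg, huw, fun x hx => le_antisymm ?_ ?_, fun x hx => ?_⟩
  -- The limits along `T` and `T'` both stabilize, so least action in both directions makes them
  -- equal.
  · obtain ⟨u', huw', hu'⟩ := exists_tendsto_odo hs hκ hμ T'
    have hs' := stable_of_tendsto hκ hμ hT' hu'
    have h1 : u x ≤ u' x := le_of_tendsto' (hu x) fun k => hs'.odo_le hκ hμ T k x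
    rw [le_antisymm h1 (huw' x)]
    exact hu' x
  · refine le_of_tendsto_of_tendsto' (hu x) ((tendsto_avg hu x).const_add (μ₀ x)) fun k => ?_
    have h1 := (consistent_process hκ hμ T k).mass_eq x
    have h2 := (consistent_process hκ hμ T k).mass_nonneg x
    linarith
  · exact hs.of_interior x (hs.mem_interior hx)
  · by_cases hr : x ∈ reach μ₀ u
    · by_cases hi : x ∈ interior (reach μ₀ u)
      · linarith [hs.of_interior x hi, hμ x]
      · linarith [hs.of_boundary x (mem_boundary_iff.2 ⟨hr, hi⟩), hμ x]
    · have h0 : ∀ j, u (x + step j) = 0 := by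
        intro j
        by_contra h
        exact hr (Or.inr ⟨x + step j, (neighbour_step x j).symm,
          lt_of_le_of_ne (hs.nonneg _) (Ne.symm h)⟩)
      simp [avg, h0, hκ.le]

end Dynamics

/-! ### Maximum principle and Bernstein's gradient estimate. -/

section Gradient

variable {d : ℕ}

/-- The square of the Euclidean norm. -/
noncomputable def sqNorm (x : Fin d → ℤ) : ℝ := ∑ i, (x i : ℝ) ^ 2

lemma sqNorm_nonneg (x : Fin d → ℤ) : 0 ≤ sqNorm x :=
  Finset.sum_nonneg fun _ _ => sq_nonneg _

lemma sq_le_sqNorm (x : Fin d → ℤ) (i : Fin d) : (x i : ℝ) ^ 2 ≤ sqNorm x :=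
  Finset.single_le_sum (f := fun i => (x i : ℝ) ^ 2) (fun _ _ => sq_nonneg _) (Finset.mem_univ i)

lemma euclNorm_eq (x : Fin d → ℤ) : euclNorm x = √(sqNorm x) := by
  simp [euclNorm, sqNorm, EuclideanSpace.norm_eq]

lemma euclNorm_nonneg (x : Fin d → ℤ) : 0 ≤ euclNorm x := norm_nonneg _

lemma euclNorm_sq (x : Fin d → ℤ) : euclNorm x ^ 2 = sqNorm x := by
  rw [euclNorm_eq, Real.sq_sqrt (sqNorm_nonneg x)]

lemma euclNorm_add_le (x y : Fin d → ℤ) : euclNorm (x + y) ≤ euclNorm x + euclNorm y := by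
  unfold euclNorm
  refine le_of_eq_of_le ?_ (norm_add_le _ _)
  congr 1
  ext i
  simp

lemma euclNorm_neg (x : Fin d → ℤ) : euclNorm (-x) = euclNorm x := by
  simp [euclNorm_eq, sqNorm]

lemma euclNorm_sub_comm (x y : Fin d → ℤ) : euclNorm (x - y) = euclNorm (y - x) := by
  rw [← euclNorm_neg, neg_sub]

lemma abs_le_euclNorm (x : Fin d → ℤ) (i : Fin d) : |(x i : ℝ)| ≤ euclNorm x := by
  rw [euclNorm_eq]
  exact Real.abs_le_sqrt (sq_le_sqNorm x i)

/-- The sign of a step. -/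
def stepSign (j : Fin d × Bool) : ℝ := cond j.2 1 (-1)

lemma stepSign_sq (j : Fin d × Bool) : stepSign j ^ 2 = 1 := by
  rcases j with ⟨i, b⟩
  cases b <;> simp [stepSign]

lemma sqNorm_add_step (x : Fin d → ℤ) (j : Fin d × Bool) :
    sqNorm (x + step j) = sqNorm x + 2 * stepSign j * x j.1 + 1 := by
  rcases j with ⟨i, b⟩
  have h : ∀ k, (((x + step (i, b)) k : ℤ) : ℝ) ^ 2 =
      (x k : ℝ) ^ 2 + if k = i then 2 * stepSign (i, b) * x i + 1 else 0 := by
    intro k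
    by_cases hk : k = i
    · subst hk
      cases b <;> simp [step, stepSign] <;> ring
    · simp [step, hk]
  unfold sqNorm
  rw [Finset.sum_congr rfl fun k _ => h k, Finset.sum_add_distrib]
  simp
  ring

lemma euclNorm_step (j : Fin d × Bool) : euclNorm (step j) = 1 := by
  have h := sqNorm_add_step (0 : Fin d → ℤ) j
  rw [euclNorm_eq, ← zero_add (step j), h]
  simp [sqNorm]

lemma euclNorm_step_sub_le (x z : Fin d → ℤ) (j : Fin d × Bool) :
    euclNorm (x + step j - z) ≤ euclNorm (x - z) + 1 := by
  have := euclNorm_add_le (x - z) (step j)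
  rw [euclNorm_step] at this
  rwa [add_sub_right_comm]

lemma sum_step {f : Fin d × Bool → ℝ} :
    ∑ j, f j = ∑ i, (f (i, true) + f (i, false)) := by
  rw [Fintype.sum_prod_type]
  simp

lemma finite_setOf_euclNorm_sub_le (x₀ : Fin d → ℤ) (R : ℝ) :
    {x : Fin d → ℤ | euclNorm (x - x₀) ≤ R}.Finite := by
  refine (Set.finite_Icc (fun i => x₀ i - ⌈R⌉) (fun i => x₀ i + ⌈R⌉)).subset ?_
  intro x hx
  have h : ∀ i, |x i - x₀ i| ≤ ⌈R⌉ := by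
    intro i
    have h1 := (abs_le_euclNorm (x - x₀) i).trans (hx.trans (Int.le_ceil R))
    simp only [Pi.sub_apply] at h1
    exact_mod_cast h1
  exact ⟨fun i => by have := abs_le.1 (h i); simp only; omega,
    fun i => by have := abs_le.1 (h i); simp only; omega⟩

lemma sum_step_sub (hd : 0 < d) (u : (Fin d → ℤ) → ℝ) (x : Fin d → ℤ) :
    ∑ j, (u (x + step j) - u x) = 2 * d * (avg u x - u x) := by
  have : (d : ℝ) ≠ 0 := by positivity
  rw [Finset.sum_sub_distrib]
  unfold avg
  simp
  field_simp

/-- The maximum principle on finite subsets of the lattice. -/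
lemma le_of_subharmonic (hd : 0 < d) {s : Set (Fin d → ℤ)} (hs : s.Finite)
    {F : (Fin d → ℤ) → ℝ} {B : ℝ}
    (hF : ∀ x ∈ s, 0 ≤ ∑ j, (F (x + step j) - F x))
    (hB : ∀ x ∈ s, ∀ j, x + step j ∉ s → F (x + step j) ≤ B) :
    ∀ x ∈ s, F x ≤ B := by
  by_contra! hc
  obtain ⟨x₁, hx₁, hBx₁⟩ := hc
  obtain ⟨x₂, hx₂, hmax⟩ := Set.exists_max_image s F hs ⟨x₁, hx₁⟩
  have hBx₂ : B < F x₂ := hBx₁.trans_le (hmax x₁ hx₁)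
  let i₀ : Fin d := ⟨0, hd⟩
  -- Among the maximizers take one with largest coordinate `i₀`. Subharmonicity makes all its
  -- neighbours maximizers, including the one further along `i₀`.
  obtain ⟨x, ⟨hx, hFx⟩, hxmax⟩ := Set.exists_max_image {x | x ∈ s ∧ F x = F x₂} (fun x => x i₀)
    (hs.subset fun x hx => hx.1) ⟨x₂, hx₂, rfl⟩
  have hle : ∀ j, F (x + step j) - F x ≤ 0 := by
    intro j
    by_cases hj : x + step j ∈ s
    · linarith [hmax _ hj]
    · linarith [hB x hx j hj]
  have h0 := (Finset.sum_eq_zero_iff_of_nonpos fun j _ => hle j).1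
    (le_antisymm (Finset.sum_nonpos fun j _ => hle j) (hF x hx)) (i₀, true) (Finset.mem_univ _)
  have hmem : x + step (i₀, true) ∈ s := by
    by_contra hj
    linarith [hB x hx _ hj]
  have := hxmax (x + step (i₀, true)) ⟨hmem, by linarith⟩
  simp [step] at this

/-- One summand in the Laplacian of `(ζ h)²`. -/
lemma sq_mul_sub_sq_mul_ge (a a' h h' : ℝ) :
    2 * a ^ 2 * h * (h' - h) + 2 * a * h ^ 2 * (a' - a) - (a' - a) ^ 2 * (2 * h ^ 2 + h' ^ 2) ≤
      (a' * h') ^ 2 - (a * h) ^ 2 := by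
  -- The difference of the two sides is exactly the sum of these two squares.
  nlinarith [sq_nonneg (a' * h' - a * h + h * (a' - a)), sq_nonneg ((a' - a) * (h - h'))]

/-- The sum of the squared differences of `u` between `x` and its neighbours. -/
noncomputable def energy (u : (Fin d → ℤ) → ℝ) (x : Fin d → ℤ) : ℝ :=
  ∑ j, (u (x + step j) - u x) ^ 2

lemma sq_sub_le_energy (u : (Fin d → ℤ) → ℝ) (x : Fin d → ℤ) (j : Fin d × Bool) :
    (u (x + step j) - u x) ^ 2 ≤ energy u x :=
  Finset.single_le_sum (f := fun j => (u (x + step j) - u x) ^ 2) (fun _ _ => sq_nonneg _)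
    (Finset.mem_univ j)

/-- Expanding the square leaves a cross term proportional to the Laplacian of u, which vanishes. The
positive energy that remains pays for the errors caused by the cutoff. -/
lemma sum_sq_sub_sq (hd : 0 < d) {u : (Fin d → ℤ) → ℝ} {x : Fin d → ℤ} (h : u x = avg u x) :
    ∑ j, (u (x + step j) ^ 2 - u x ^ 2) = energy u x := by
  have h1 : ∀ j : Fin d × Bool, u (x + step j) ^ 2 - u x ^ 2 =
      (u (x + step j) - u x) ^ 2 + 2 * u x * (u (x + step j) - u x) := fun j => by ring
  rw [Finset.sum_congr rfl fun j _ => h1 j, Finset.sum_add_distrib, ← Finset.mul_sum,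
    sum_step_sub hd, ← h, energy]
  ring

/-- A quadratic cutoff function around `x₀`. -/
noncomputable def cutoff (x₀ : Fin d → ℤ) (ρ : ℝ) (x : Fin d → ℤ) : ℝ :=
  1 - euclNorm (x - x₀) ^ 2 / ρ ^ 2

lemma cutoff_step_sub (x₀ : Fin d → ℤ) (ρ : ℝ) (x : Fin d → ℤ) (j : Fin d × Bool) :
    cutoff x₀ ρ (x + step j) - cutoff x₀ ρ x =
      -(2 * stepSign j * (x - x₀) j.1 + 1) / ρ ^ 2 := by
  unfold cutoff
  rw [add_sub_right_comm, euclNorm_sq, euclNorm_sq, sqNorm_add_step]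
  ring

lemma sum_cutoff_step_sub (x₀ : Fin d → ℤ) (ρ : ℝ) (x : Fin d → ℤ) :
    ∑ j, (cutoff x₀ ρ (x + step j) - cutoff x₀ ρ x) = -(2 * d / ρ ^ 2) := by
  rw [Finset.sum_congr rfl fun j _ => cutoff_step_sub x₀ ρ x j, sum_step]
  have : ∀ i : Fin d, -(2 * stepSign (i, true) * ((x - x₀) i : ℤ) + 1) / ρ ^ 2 +
      -(2 * stepSign (i, false) * ((x - x₀) i : ℤ) + 1) / ρ ^ 2 = -(2 / ρ ^ 2) := by
    intro i
    simp [stepSign]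
    ring
  rw [Finset.sum_congr rfl fun i _ => this i]
  simp
  ring

lemma sq_cutoff_step_sub_le {x₀ : Fin d → ℤ} {ρ : ℝ} (hρ : 1 ≤ ρ) {x : Fin d → ℤ}
    (hx : euclNorm (x - x₀) ≤ ρ) (j : Fin d × Bool) :
    (cutoff x₀ ρ (x + step j) - cutoff x₀ ρ x) ^ 2 ≤ 9 / ρ ^ 2 := by
  have hρ0 : 0 < ρ := by linarith
  have h1 := (abs_le_euclNorm (x - x₀) j.1).trans hx
  have h2 : |2 * stepSign j * (x - x₀) j.1 + 1| ≤ 3 * ρ := by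
    have hs : |stepSign j| = 1 := by
      rw [← Real.sqrt_sq_eq_abs, stepSign_sq, Real.sqrt_one]
    calc |2 * stepSign j * (x - x₀) j.1 + 1|
        ≤ |2 * stepSign j * (x - x₀) j.1| + |(1 : ℝ)| := abs_add_le _ _
      _ = 2 * |(((x - x₀) j.1 : ℤ) : ℝ)| + 1 := by rw [abs_mul, abs_mul, hs]; simp
      _ ≤ 3 * ρ := by linarith
  rw [cutoff_step_sub, div_pow, neg_sq, div_le_div_iff₀ (by positivity) (by positivity)]
  have h3 : (2 * stepSign j * (x - x₀) j.1 + 1) ^ 2 ≤ (3 * ρ) ^ 2 := by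
    rw [← sq_abs]
    gcongr
  calc _ ≤ (3 * ρ) ^ 2 * ρ ^ 2 := by gcongr
    _ = _ := by ring

/-- Bernstein's computation: the sum of the squared gradient with a cutoff and of a multiple of
the squared function is subharmonic. -/
lemma bernstein_subharmonic (hd : 0 < d) {u : (Fin d → ℤ) → ℝ} {x₀ : Fin d → ℤ} {ρ : ℝ}
    (hρ : 1 ≤ ρ) (e : Fin d × Bool) {x : Fin d → ℤ} (hx : euclNorm (x - x₀) ≤ ρ)
    (h : u x = avg u x) (h' : u (x + step e) = avg u (x + step e))
    {F : (Fin d → ℤ) → ℝ} (hF : ∀ x, F x = (cutoff x₀ ρ x * (u (x + step e) - u x)) ^ 2 +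
      (94 * d + 27) / ρ ^ 2 * (u x ^ 2 + u (x + step e) ^ 2)) :
    0 ≤ ∑ j, (F (x + step j) - F x) := by
  have hρ0 : 0 < ρ := by linarith
  set v : (Fin d → ℤ) → ℝ := fun x => u (x + step e) with hv
  set g : (Fin d → ℤ) → ℝ := fun x => v x - u x with hg
  set ζ := cutoff x₀ ρ with hζ
  set E := energy u x with hE
  set E' := energy v x with hE'
  have hvavg : v x = avg v x := by
    simp only [hv, avg, add_right_comm x _ (step e)]
    exact h'
  have hE0 : 0 ≤ E := Finset.sum_nonneg fun _ _ => sq_nonneg _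
  have hE0' : 0 ≤ E' := Finset.sum_nonneg fun _ _ => sq_nonneg _
  have hζ1 : ζ x ≤ 1 := by
    have : 0 ≤ euclNorm (x - x₀) ^ 2 / ρ ^ 2 := by positivity
    simp only [hζ, cutoff]; linarith
  have hζ0 : 0 ≤ ζ x := by
    have : euclNorm (x - x₀) ^ 2 / ρ ^ 2 ≤ 1 := by
      rw [div_le_one (by positivity)]
      have := euclNorm_nonneg (x - x₀)
      gcongr
    simp only [hζ, cutoff]; linarith
  have hg2 : g x ^ 2 ≤ E := sq_sub_le_energy u x e
  have hgsum : ∑ j, g (x + step j) ^ 2 ≤ 3 * E + 3 * E' + 6 * d * E := by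
    have h1 : ∀ j : Fin d × Bool, g (x + step j) ^ 2 ≤
        3 * (u (x + step j) - u x) ^ 2 + 3 * (v (x + step j) - v x) ^ 2 + 3 * E := by
      intro j
      have h2 : g (x + step j) = -(u (x + step j) - u x) + (v (x + step j) - v x) + g x := by
        simp only [hg]; ring
      rw [h2]
      nlinarith [sq_nonneg (-(u (x + step j) - u x) - (v (x + step j) - v x)),
        sq_nonneg (-(u (x + step j) - u x) - g x), sq_nonneg ((v (x + step j) - v x) - g x)]
    refine (Finset.sum_le_sum fun j _ => h1 j).trans_eq ?_
    rw [Finset.sum_add_distrib, Finset.sum_add_distrib, ← Finset.mul_sum, ← Finset.mul_sum]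
    simp only [hE, hE', energy, Finset.sum_const, Finset.card_univ, Fintype.card_prod,
      Fintype.card_fin, Fintype.card_bool, nsmul_eq_mul]
    push_cast
    ring
  have hglap : ∑ j, (g (x + step j) - g x) = 0 := by
    have h1 : ∀ j : Fin d × Bool, g (x + step j) - g x =
      (v (x + step j) - v x) - (u (x + step j) - u x) := fun j => by simp only [hg]; ring
    rw [Finset.sum_congr rfl fun j _ => h1 j, Finset.sum_sub_distrib, sum_step_sub hd,
      sum_step_sub hd, ← h, ← hvavg]
    ring
  have hlow : ∀ j : Fin d × Bool, 2 * ζ x ^ 2 * g x * (g (x + step j) - g x) +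
      2 * ζ x * g x ^ 2 * (ζ (x + step j) - ζ x) - 9 / ρ ^ 2 * (2 * g x ^ 2 + g (x + step j) ^ 2) +
      (94 * d + 27) / ρ ^ 2 * (u (x + step j) ^ 2 - u x ^ 2) +
      (94 * d + 27) / ρ ^ 2 * (v (x + step j) ^ 2 - v x ^ 2) ≤ F (x + step j) - F x := by
    intro j
    have h1 := sq_mul_sub_sq_mul_ge (ζ x) (ζ (x + step j)) (g x) (g (x + step j))
    have h2 : (ζ (x + step j) - ζ x) ^ 2 * (2 * g x ^ 2 + g (x + step j) ^ 2) ≤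
        9 / ρ ^ 2 * (2 * g x ^ 2 + g (x + step j) ^ 2) := by
      gcongr
      exact sq_cutoff_step_sub_le hρ hx j
    rw [hF, hF]
    change _ ≤ (ζ (x + step j) * g (x + step j)) ^ 2 +
      (94 * d + 27) / ρ ^ 2 * (u (x + step j) ^ 2 + v (x + step j) ^ 2) -
      ((ζ x * g x) ^ 2 + (94 * d + 27) / ρ ^ 2 * (u x ^ 2 + v x ^ 2))
    linarith
  refine le_trans ?_ (Finset.sum_le_sum fun j _ => hlow j)
  rw [Finset.sum_add_distrib, Finset.sum_add_distrib, Finset.sum_sub_distrib,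
    Finset.sum_add_distrib, ← Finset.mul_sum, ← Finset.mul_sum, ← Finset.mul_sum, ← Finset.mul_sum,
    ← Finset.mul_sum, hglap, sum_cutoff_step_sub, sum_sq_sub_sq hd h, sum_sq_sub_sq hd hvavg,
    Finset.sum_add_distrib]
  simp only [Finset.sum_const, Finset.card_univ, Fintype.card_prod,
      Fintype.card_fin, Fintype.card_bool, nsmul_eq_mul]
  rw [← hE, ← hE']
  have hρi : 0 < 1 / ρ ^ 2 := by positivity
  have h3 : ζ x * g x ^ 2 ≤ E := by nlinarith [sq_nonneg (g x)]
  have hd0 : (0 : ℝ) ≤ d := by positivity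
  -- Source of the constant: 4d from the Laplacian of the cutoff, 9·4d from `g x ^ 2`, and 9·(6d +
  -- 3) from the neighbouring values of `g`; together 94d + 27.
  have key : 0 ≤ -(4 * d * (ζ x * g x ^ 2)) - 9 * (4 * d * g x ^ 2 + ∑ j, g (x + step j) ^ 2) +
      (94 * d + 27) * E + (94 * d + 27) * E' := by
    nlinarith [mul_le_mul_of_nonneg_left h3 hd0, mul_le_mul_of_nonneg_left hg2 hd0,
      mul_nonneg hd0 hE0, mul_nonneg hd0 hE0']
  have := mul_nonneg hρi.le key
  refine this.trans_eq ?_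
  push_cast
  ring

/-- The interior gradient estimate for nonnegative solutions of the discrete free boundary
problem. -/
theorem sq_step_sub_le (hd : 0 < d) {u : (Fin d → ℤ) → ℝ} (hu : ∀ x, 0 ≤ u x) {κ : ℝ}
    {x₀ : Fin d → ℤ} {ρ M : ℝ} (hρ : 1 ≤ ρ)
    (hM : ∀ x, euclNorm (x - x₀) ≤ 3 * ρ → u x ≤ M)
    (hpos : ∀ x, euclNorm (x - x₀) ≤ 3 * ρ → 0 < u x → u x = avg u x)
    (hzero : ∀ x, u x = 0 → avg u x ≤ κ) (e : Fin d × Bool) :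
    (u (x₀ + step e) - u x₀) ^ 2 ≤ (2 * d * κ) ^ 2 + (188 * d + 63) * M ^ 2 / ρ ^ 2 := by
  have hρ0 : 0 < ρ := by linarith
  have hd0 : (0 : ℝ) < d := by positivity
  set F : (Fin d → ℤ) → ℝ := fun x => (cutoff x₀ ρ x * (u (x + step e) - u x)) ^ 2 +
      (94 * d + 27) / ρ ^ 2 * (u x ^ 2 + u (x + step e) ^ 2) with hF
  set B := (2 * d * κ) ^ 2 + (188 * d + 63) * M ^ 2 / ρ ^ 2 with hB
  have hnbr : ∀ x, u x = 0 → ∀ y, Neighbour y x → u y ≤ 2 * d * κ := by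
    intro x hx y hy
    obtain ⟨j, rfl⟩ := neighbour_iff.1 hy
    have h1 := hzero x hx
    have h2 := Finset.single_le_sum (f := fun j => u (x + step j)) (fun j _ => hu _)
      (Finset.mem_univ j)
    unfold avg at h1
    rw [div_le_iff₀ (by positivity)] at h1
    linarith
  have hgrad : ∀ x, u x = 0 ∨ u (x + step e) = 0 → (u (x + step e) - u x) ^ 2 ≤ (2 * d * κ) ^ 2 := by
    rintro x (hx | hx)
    · have := hnbr x hx _ (neighbour_step x e)
      rw [hx, sub_zero]
      have := hu (x + step e)
      gcongr
    · have := hnbr _ hx _ (neighbour_step x e).symm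
      rw [hx, zero_sub, neg_sq]
      have := hu x
      gcongr
  -- A point just outside the ball is at distance at most ρ + 1, and its shift by `e` at most ρ + 2
  -- ≤ 3ρ.
  have hsq : ∀ x, euclNorm (x - x₀) ≤ ρ + 1 →
      (u (x + step e) - u x) ^ 2 ≤ M ^ 2 ∧ (94 * d + 27) / ρ ^ 2 * (u x ^ 2 + u (x + step e) ^ 2) ≤
        (188 * d + 54) * M ^ 2 / ρ ^ 2 := by
    intro x hx
    have h1 := hM x (by linarith)
    have h2 := hM (x + step e) (by linarith [euclNorm_step_sub_le x x₀ e])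
    have h3 := hu x
    have h4 := hu (x + step e)
    have h5 : u x ^ 2 ≤ M ^ 2 := by gcongr
    have h6 : u (x + step e) ^ 2 ≤ M ^ 2 := by gcongr
    constructor
    · nlinarith
    · calc (94 * d + 27) / ρ ^ 2 * (u x ^ 2 + u (x + step e) ^ 2)
          ≤ (94 * d + 27) / ρ ^ 2 * (M ^ 2 + M ^ 2) := by gcongr
        _ = _ := by ring
  have hcut : ∀ x, euclNorm (x - x₀) ≤ ρ → cutoff x₀ ρ x ^ 2 ≤ 1 := by
    intro x hx
    have h0 := euclNorm_nonneg (x - x₀)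
    have h1 : euclNorm (x - x₀) ^ 2 / ρ ^ 2 ≤ 1 := by
      rw [div_le_one (by positivity)]
      gcongr
    have h2 : 0 ≤ euclNorm (x - x₀) ^ 2 / ρ ^ 2 := by positivity
    have h3 : cutoff x₀ ρ x = 1 - euclNorm (x - x₀) ^ 2 / ρ ^ 2 := rfl
    rw [h3]
    nlinarith
  -- Here u is harmonic at both ends of the edge in direction `e`. A path leaves `s` either at an
  -- edge touching the zero set, where `hgrad` applies, or through the edge of the ball, where the
  -- cutoff is small.
  set s : Set (Fin d → ℤ) := {x | euclNorm (x - x₀) ≤ ρ ∧ 0 < u x ∧ 0 < u (x + step e)} with hs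
  have hfin : s.Finite := (finite_setOf_euclNorm_sub_le x₀ ρ).subset fun x hx => hx.1
  have hx₀ : euclNorm (x₀ - x₀) ≤ ρ := by
    rw [sub_self, euclNorm_eq]
    simp [sqNorm, hρ0.le]
  have hMρ : 0 ≤ (188 * d + 63) * M ^ 2 / ρ ^ 2 := by positivity
  by_cases hmem : x₀ ∈ s
  swap
  · have h1 : u x₀ = 0 ∨ u (x₀ + step e) = 0 := by
      by_contra! hc
      exact hmem ⟨hx₀, lt_of_le_of_ne (hu _) (Ne.symm hc.1), lt_of_le_of_ne (hu _) (Ne.symm hc.2)⟩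
    linarith [hgrad x₀ h1]
  have hmain : F x₀ ≤ B := by
    refine le_of_subharmonic hd hfin (F := F) (fun x hx => ?_) (fun x hx j hj => ?_) x₀ hmem
    · refine bernstein_subharmonic hd hρ e hx.1 (hpos x (by linarith [hx.1]) hx.2.1)
        (hpos _ ?_ hx.2.2) fun x => rfl
      linarith [hx.1, euclNorm_step_sub_le x x₀ e]
    · have h1 := euclNorm_step_sub_le x x₀ j
      have hxρ := hx.1
      set y := x + step j with hy
      obtain ⟨h2, h3⟩ := hsq y (by linarith)
      have h4 : (cutoff x₀ ρ y * (u (y + step e) - u y)) ^ 2 ≤ (2 * d * κ) ^ 2 + 9 * M ^ 2 / ρ ^ 2 := by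
        rw [mul_pow]
        by_cases hyρ : euclNorm (y - x₀) ≤ ρ
        · have h5 : u y = 0 ∨ u (y + step e) = 0 := by
            by_contra! hc
            exact hj ⟨hyρ, lt_of_le_of_ne (hu _) (Ne.symm hc.1),
              lt_of_le_of_ne (hu _) (Ne.symm hc.2)⟩
          have h6 := hgrad y h5
          have h7 := hcut y hyρ
          have h8 : 0 ≤ 9 * M ^ 2 / ρ ^ 2 := by positivity
          nlinarith [sq_nonneg (u (y + step e) - u y)]
        · push Not at hyρ
          have h5 : cutoff x₀ ρ y ≤ 0 := by
            have : 1 ≤ euclNorm (y - x₀) ^ 2 / ρ ^ 2 := by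
              rw [one_le_div (by positivity)]
              gcongr
            simp only [cutoff]; linarith
          have h6 : 0 ≤ cutoff x₀ ρ x := by
            have h0 := euclNorm_nonneg (x - x₀)
            have : euclNorm (x - x₀) ^ 2 / ρ ^ 2 ≤ 1 := by
              rw [div_le_one (by positivity)]
              gcongr
            simp only [cutoff]; linarith
          have h7 := sq_cutoff_step_sub_le hρ hxρ j
          -- The cutoff changes sign between `x` and `y`, so its size at `y` is at most its
          -- increment.
          have h8 : cutoff x₀ ρ y ^ 2 ≤ 9 / ρ ^ 2 := by
            refine le_trans ?_ h7
            rw [← hy]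
            nlinarith
          calc cutoff x₀ ρ y ^ 2 * (u (y + step e) - u y) ^ 2 ≤ 9 / ρ ^ 2 * M ^ 2 := by gcongr
            _ = 9 * M ^ 2 / ρ ^ 2 := by ring
            _ ≤ _ := by linarith [sq_nonneg (2 * d * κ)]
      have h5 : B = (2 * d * κ) ^ 2 + 9 * M ^ 2 / ρ ^ 2 + (188 * d + 54) * M ^ 2 / ρ ^ 2 := by
        rw [hB]; ring
      rw [h5]
      exact add_le_add h4 h3
  refine le_trans ?_ hmain
  have h1 : cutoff x₀ ρ x₀ = 1 := by
    simp [cutoff, euclNorm_eq, sqNorm]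
  simp only [hF, h1, one_mul]
  have : 0 ≤ (94 * d + 27) / ρ ^ 2 * (u x₀ ^ 2 + u (x₀ + step e) ^ 2) := by positivity
  linarith

/-- A bound for the differences along the edges of a ball bounds the oscillation in the ball. -/
lemma abs_sub_le_of_step {u : (Fin d → ℤ) → ℝ} {B R : ℝ} (hB : 0 ≤ B) {y : Fin d → ℤ}
    (h : ∀ z j, euclNorm (z - y) ≤ R → |u (z + step j) - u z| ≤ B) {x : Fin d → ℤ}
    (hx : euclNorm (x - y) ≤ R) : |u x - u y| ≤ d * B * euclNorm (x - y) := by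
  have key : ∀ m : ℕ, ∀ x, euclNorm (x - y) ≤ R → ∑ i, |x i - y i| = (m : ℤ) →
      |u x - u y| ≤ m * B := by
    intro m
    induction m with
    | zero =>
      intro x _ hm
      have : x = y := by
        funext i
        have := (Finset.sum_eq_zero_iff_of_nonneg fun k _ => abs_nonneg (x k - y k)).1
          (by exact_mod_cast hm) i (Finset.mem_univ i)
        have := abs_eq_zero.1 this
        omega
      simp [this]
    | succ m ih =>
      intro x hx hm
      have hne : ∃ i, x i ≠ y i := by
        by_contra! hc
        simp [hc] at hm
        omega
      obtain ⟨i, hi⟩ := hne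
      -- A step towards `y` in a coordinate that differs lowers the ℓ¹-distance by one and does not
      -- increase the Euclidean distance, so the path stays in the ball.
      obtain ⟨b, hb⟩ : ∃ b : Bool, |(x + step (i, b)) i - y i| + 1 = |x i - y i| := by
        rcases lt_or_gt_of_ne hi with hlt | hlt
        · refine ⟨true, ?_⟩
          simp only [step, Pi.add_apply, Pi.single_eq_same, cond_true]
          rw [abs_of_nonpos (by omega), abs_of_neg (by omega)]
          omega
        · refine ⟨false, ?_⟩
          simp only [step, Pi.add_apply, Pi.single_eq_same, cond_false]
          rw [abs_of_nonneg (by omega), abs_of_pos (by omega)]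
          omega
      have hoff : ∀ k, k ≠ i → (x + step (i, b)) k = x k := by
        intro k hk
        simp [step, hk]
      have hsum : ∑ k, |(x + step (i, b)) k - y k| = (m : ℤ) := by
        rw [← Finset.add_sum_erase _ _ (Finset.mem_univ i)] at hm ⊢
        rw [Finset.sum_congr rfl fun k hk => by rw [hoff k (Finset.ne_of_mem_erase hk)]]
        push_cast at hm
        omega
      have hnorm : euclNorm (x + step (i, b) - y) ≤ euclNorm (x - y) := by
        rw [euclNorm_eq, euclNorm_eq]
        refine Real.sqrt_le_sqrt (Finset.sum_le_sum fun k _ => ?_)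
        rw [sq_le_sq]
        simp only [Pi.sub_apply]
        by_cases hk : k = i
        · subst hk
          have : |(x + step (k, b)) k - y k| ≤ |x k - y k| := by omega
          exact_mod_cast this
        · rw [hoff k hk]
      have h1 := ih _ (hnorm.trans hx) hsum
      have h2 := h x (i, b) hx
      rw [abs_sub_comm] at h2
      have h3 := abs_sub_le (u x) (u (x + step (i, b))) (u y)
      push_cast
      linarith
  obtain ⟨m, hm⟩ := Int.eq_ofNat_of_zero_le
    (Finset.sum_nonneg fun i (_ : i ∈ Finset.univ) => abs_nonneg (x i - y i))
  have h1 := key m x hx hm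
  have h2 : (m : ℝ) ≤ d * euclNorm (x - y) := by
    have h3 : (m : ℝ) = ∑ i, |((x - y) i : ℝ)| := by
      have : ((∑ i, |x i - y i| : ℤ) : ℝ) = (m : ℝ) := by rw [hm]; simp
      rw [← this]
      push_cast
      simp
    rw [h3]
    refine (Finset.sum_le_sum fun i _ => abs_le_euclNorm (x - y) i).trans_eq ?_
    simp
  calc |u x - u y| ≤ m * B := h1
    _ ≤ d * euclNorm (x - y) * B := by gcongr
    _ = _ := by ring

end Gradient

/-! ### The barrier: a discrete supersolution built from the fundamental solution. -/

section Barrier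

/-- For p = d/2, `F (|x|²)` is up to constants the fundamental solution: logarithmic if d = 2, a
multiple of |x|^{2-d} if d ≥ 3. -/
lemma exists_antideriv_rpow (p : ℝ) :
    ∃ F : ℝ → ℝ, ∀ b, 0 < b → HasDerivAt F (-b ^ (-p)) b := by
  by_cases hp : p = 1
  · refine ⟨fun b => -Real.log b, fun b hb => ?_⟩
    rw [hp, Real.rpow_neg_one]
    exact (Real.hasDerivAt_log hb.ne').neg
  · have hp' : 1 - p ≠ 0 := sub_ne_zero.2 (Ne.symm hp)
    refine ⟨fun b => -(b ^ (1 - p) / (1 - p)), fun b hb => ?_⟩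
    have h := ((Real.hasDerivAt_rpow_const (p := 1 - p) (Or.inl hb.ne')).div_const (1 - p)).neg
    refine h.congr_deriv ?_
    rw [mul_div_cancel_left₀ _ hp']
    congr 2
    ring

lemma nonneg_of_hasDerivAt {g g' : ℝ → ℝ} {a : ℝ} (h0 : 0 ≤ g 0)
    (hg : ∀ t ∈ Set.Icc 0 a, HasDerivAt g (g' t) t) (hg' : ∀ t ∈ Set.Icc 0 a, 0 ≤ g' t) :
    ∀ t ∈ Set.Icc 0 a, 0 ≤ g t := by
  intro t ht
  have hmono : MonotoneOn g (Set.Icc 0 a) :=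
    monotoneOn_of_hasDerivWithinAt_nonneg (convex_Icc 0 a)
      (fun t ht => (hg t ht).continuousAt.continuousWithinAt)
      (fun t ht => (hg t (interior_subset ht)).hasDerivWithinAt)
      (fun t ht => hg' t (interior_subset ht))
  exact h0.trans (hmono ⟨le_rfl, ht.1.trans ht.2⟩ ht ht.1)

/-- Taylor's formula with fourth-order remainder. The fourth derivative of F is p(p+1)(p+2)b^{-p-3},
at most 2^{p+3} times larger at points no less than b/2; integrating that bound four times from h =
0 gives the claim. -/
lemma second_difference_le {p : ℝ} (hp : 0 ≤ p) {F : ℝ → ℝ}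
    (hF : ∀ b, 0 < b → HasDerivAt F (-b ^ (-p)) b) {b h : ℝ} (hb : 0 < b) (hh : 0 ≤ h)
    (hhb : h ≤ b / 2) :
    F (b + h) + F (b - h) - 2 * F b ≤ p * b ^ (-p - 1) * h ^ 2 +
      p * (p + 1) * (p + 2) * 2 ^ (p + 3) / 12 * b ^ (-p - 3) * h ^ 4 := by
  set K := p * (p + 1) * (p + 2) * 2 ^ (p + 3) / 12 with hK
  have hplus : ∀ t ∈ Set.Icc 0 (b / 2), 0 < b + t := fun t ht => by linarith [ht.1]
  have hminus : ∀ t ∈ Set.Icc 0 (b / 2), 0 < b - t := fun t ht => by linarith [ht.2]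
  have hdplus : ∀ q : ℝ, ∀ t ∈ Set.Icc 0 (b / 2),
      HasDerivAt (fun t => (b + t) ^ q) (q * (b + t) ^ (q - 1)) t := fun q t ht => by
    simpa using ((hasDerivAt_id t).const_add b).rpow_const (p := q) (Or.inl (hplus t ht).ne')
  have hdminus : ∀ q : ℝ, ∀ t ∈ Set.Icc 0 (b / 2),
      HasDerivAt (fun t => (b - t) ^ q) (-(q * (b - t) ^ (q - 1))) t := fun q t ht => by
    simpa using ((hasDerivAt_id t).const_sub b).rpow_const (p := q) (Or.inl (hminus t ht).ne')
  have hFplus : ∀ t ∈ Set.Icc 0 (b / 2),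
      HasDerivAt (fun t => F (b + t)) (-(b + t) ^ (-p)) t := fun t ht => by
    exact ((hF (b + t) (hplus t ht)).comp t ((hasDerivAt_id t).const_add b)).congr_deriv (by simp)
  have hFminus : ∀ t ∈ Set.Icc 0 (b / 2),
      HasDerivAt (fun t => F (b - t)) ((b - t) ^ (-p)) t := fun t ht => by
    exact ((hF (b - t) (hminus t ht)).comp t ((hasDerivAt_id t).const_sub b)).congr_deriv (by simp)
  have hpow : ∀ c : ℝ, ∀ m : ℕ, ∀ t : ℝ,
      HasDerivAt (fun t => c * t ^ m) (c * (m * t ^ (m - 1))) t := fun c m t =>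
    (hasDerivAt_pow m t).const_mul c
  have h4 : ∀ t ∈ Set.Icc 0 (b / 2), 0 ≤ 24 * K * b ^ (-p - 3) -
      p * (p + 1) * (p + 2) * (b + t) ^ (-p - 3) - p * (p + 1) * (p + 2) * (b - t) ^ (-p - 3) := by
    intro t ht
    have e : 2 ^ (p + 3) * b ^ (-p - 3) = (b / 2) ^ (-p - 3) := by
      rw [Real.div_rpow hb.le (by norm_num), div_eq_mul_inv, ← Real.rpow_neg (by norm_num), mul_comm]
      congr 2
      ring
    have e1 : (b + t) ^ (-p - 3) ≤ (b / 2) ^ (-p - 3) :=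
      Real.rpow_le_rpow_of_nonpos (by linarith) (by linarith [ht.1]) (by linarith)
    have e2 : (b - t) ^ (-p - 3) ≤ (b / 2) ^ (-p - 3) :=
      Real.rpow_le_rpow_of_nonpos (by linarith) (by linarith [ht.2]) (by linarith)
    have e3 : 24 * K * b ^ (-p - 3) = 2 * (p * (p + 1) * (p + 2)) * (b / 2) ^ (-p - 3) := by
      rw [← e, hK]; ring
    have hpp : 0 ≤ p * (p + 1) * (p + 2) := by positivity
    rw [e3]
    nlinarith [mul_le_mul_of_nonneg_left e1 hpp, mul_le_mul_of_nonneg_left e2 hpp]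
  have h3 : ∀ t ∈ Set.Icc 0 (b / 2), 0 ≤ 24 * K * b ^ (-p - 3) * t ^ 1 +
      p * (p + 1) * (b + t) ^ (-p - 2) - p * (p + 1) * (b - t) ^ (-p - 2) := by
    refine nonneg_of_hasDerivAt (by simp) (fun t ht => ?_) h4
    refine HasDerivAt.congr_deriv (((hpow (24 * K * b ^ (-p - 3)) 1 t).add
      ((hdplus (-p - 2) t ht).const_mul (p * (p + 1)))).sub
      ((hdminus (-p - 2) t ht).const_mul (p * (p + 1)))) ?_
    rw [show -p - 2 - 1 = -p - 3 by ring]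
    push_cast
    ring
  have h2 : ∀ t ∈ Set.Icc 0 (b / 2), 0 ≤ 12 * K * b ^ (-p - 3) * t ^ 2 + 2 * p * b ^ (-p - 1) -
      p * (b + t) ^ (-p - 1) - p * (b - t) ^ (-p - 1) := by
    refine nonneg_of_hasDerivAt (le_of_eq (by simp; ring)) (fun t ht => ?_) h3
    refine HasDerivAt.congr_deriv ((((hpow (12 * K * b ^ (-p - 3)) 2 t).add_const (2 * p * b ^ (-p - 1))).sub
      ((hdplus (-p - 1) t ht).const_mul p)).sub ((hdminus (-p - 1) t ht).const_mul p)) ?_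
    rw [show -p - 1 - 1 = -p - 2 by ring]
    push_cast
    ring
  have h1 : ∀ t ∈ Set.Icc 0 (b / 2), 0 ≤ 4 * K * b ^ (-p - 3) * t ^ 3 + 2 * p * b ^ (-p - 1) * t ^ 1 +
      (b + t) ^ (-p) - (b - t) ^ (-p) := by
    refine nonneg_of_hasDerivAt (by simp) (fun t ht => ?_) h2
    refine HasDerivAt.congr_deriv ((((hpow (4 * K * b ^ (-p - 3)) 3 t).add (hpow (2 * p * b ^ (-p - 1)) 1 t)).add
      (hdplus (-p) t ht)).sub (hdminus (-p) t ht)) ?_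
    push_cast
    ring
  have h0 : ∀ t ∈ Set.Icc 0 (b / 2), 0 ≤ K * b ^ (-p - 3) * t ^ 4 + p * b ^ (-p - 1) * t ^ 2 -
      F (b + t) - F (b - t) + 2 * F b := by
    refine nonneg_of_hasDerivAt (le_of_eq (by simp; ring)) (fun t ht => ?_) h1
    refine HasDerivAt.congr_deriv (((((hpow (K * b ^ (-p - 3)) 4 t).add (hpow (p * b ^ (-p - 1)) 2 t)).sub
      (hFplus t ht)).sub (hFminus t ht)).add_const (2 * F b)) ?_
    push_cast
    ring
  linarith [h0 h ⟨hh, hhb⟩]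

lemma sub_le_of_antideriv {p : ℝ} (hp : 0 ≤ p) {F : ℝ → ℝ}
    (hF : ∀ b, 0 < b → HasDerivAt F (-b ^ (-p)) b) {a b : ℝ} (ha : 0 < a) (hab : a ≤ b) :
    b ^ (-p) * (b - a) ≤ F a - F b ∧ F a - F b ≤ a ^ (-p) * (b - a) := by
  rcases hab.eq_or_lt with rfl | hlt
  · simp
  obtain ⟨c, hc, hce⟩ := exists_hasDerivAt_eq_slope F (fun b => -b ^ (-p)) hlt
    (fun x hx => (hF x (ha.trans_le hx.1)).continuousAt.continuousWithinAt)
    (fun x hx => hF x (ha.trans hx.1))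
  have hba : 0 < b - a := by linarith
  rw [eq_div_iff hba.ne'] at hce
  have h1 : c ^ (-p) ≤ a ^ (-p) := Real.rpow_le_rpow_of_nonpos ha hc.1.le (by linarith)
  have h2 : b ^ (-p) ≤ c ^ (-p) := Real.rpow_le_rpow_of_nonpos (ha.trans hc.1) hc.2.le (by linarith)
  have h3 : F a - F b = c ^ (-p) * (b - a) := by linarith
  rw [h3]
  exact ⟨by gcongr, by gcongr⟩

variable {d : ℕ}

/-- For large `c`, the function `F (|x|² + c)` is superharmonic on the lattice. -/
lemma avg_barrier_le (hd : 0 < d) {F : ℝ → ℝ}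
    (hF : ∀ b, 0 < b → HasDerivAt F (-b ^ (-(d / 2 : ℝ))) b) {c : ℝ} (hc : 3 ≤ c)
    (hcK : 16 * ((d / 2 : ℝ) * (d / 2 + 1) * (d / 2 + 2) * 2 ^ (d / 2 + 3 : ℝ) / 12) ≤ c)
    (x : Fin d → ℤ) :
    avg (fun y => F (sqNorm y + c)) x ≤ F (sqNorm x + c) := by
  have hd1 : (1 : ℝ) ≤ d := by exact_mod_cast hd
  set p : ℝ := d / 2 with hp
  have hp0 : 0 ≤ p := by positivity
  set K := p * (p + 1) * (p + 2) * 2 ^ (p + 3) / 12 with hK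
  set s := sqNorm x with hs
  have hs0 : 0 ≤ s := sqNorm_nonneg x
  -- Opposite neighbours have squared norms s + 1 ± 2xᵢ, so their arguments are symmetric about this
  -- `b`.
  set b := s + 1 + c with hb
  have hb0 : 0 < b := by positivity
  have hpair : ∀ i, F (sqNorm (x + step (i, true)) + c) + F (sqNorm (x + step (i, false)) + c) ≤
      2 * F b + p * b ^ (-p - 1) * (4 * (x i : ℝ) ^ 2) +
        K * b ^ (-p - 3) * (16 * ((x i : ℝ) ^ 2 * s)) := by
    intro i
    have h1 := sqNorm_add_step x (i, true)
    have h2 := sqNorm_add_step x (i, false)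
    simp only [stepSign, cond_true, cond_false] at h1 h2
    have hxi : (x i : ℝ) ^ 2 ≤ s := sq_le_sqNorm x i
    have h3 := second_difference_le hp0 hF hb0 (h := |2 * (x i : ℝ)|) (abs_nonneg _) (by
      rw [abs_mul, abs_two, hb]
      nlinarith [sq_nonneg (|(x i : ℝ)| - 2), sq_abs (x i : ℝ)])
    have h4 : F (sqNorm (x + step (i, true)) + c) + F (sqNorm (x + step (i, false)) + c) =
        F (b + |2 * (x i : ℝ)|) + F (b - |2 * (x i : ℝ)|) := by
      rw [h1, h2, ← hs]
      rcases abs_choice (2 * (x i : ℝ)) with h | h <;> rw [h]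
      · congr 2 <;> ring
      · rw [add_comm]
        congr 2 <;> ring
    have h5 : |2 * (x i : ℝ)| ^ 2 = 4 * (x i : ℝ) ^ 2 := by rw [sq_abs]; ring
    have h6 : |2 * (x i : ℝ)| ^ 4 = 16 * ((x i : ℝ) ^ 2 * (x i : ℝ) ^ 2) := by
      rw [show |2 * (x i : ℝ)| ^ 4 = (|2 * (x i : ℝ)| ^ 2) ^ 2 by ring, h5]; ring
    have h7 : K * b ^ (-p - 3) * (16 * ((x i : ℝ) ^ 2 * (x i : ℝ) ^ 2)) ≤
        K * b ^ (-p - 3) * (16 * ((x i : ℝ) ^ 2 * s)) := by gcongr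
    rw [h5, h6, ← hK] at h3
    linarith
  have hsum : ∑ j, F (sqNorm (x + step j) + c) ≤
      2 * d * F b + p * b ^ (-p - 1) * (4 * s) + K * b ^ (-p - 3) * (16 * (s * s)) := by
    rw [sum_step]
    refine (Finset.sum_le_sum fun i _ => hpair i).trans_eq ?_
    rw [Finset.sum_add_distrib, Finset.sum_add_distrib, ← Finset.mul_sum, ← Finset.mul_sum,
      ← Finset.mul_sum, ← Finset.mul_sum, ← Finset.mul_sum, ← Finset.sum_mul]
    simp only [Finset.sum_const, Finset.card_univ, Fintype.card_fin, nsmul_eq_mul]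
    change _ + p * b ^ (-p - 1) * (4 * s) + K * b ^ (-p - 3) * (16 * (s * s)) = _
    ring
  have hdiff := (sub_le_of_antideriv hp0 hF (a := s + c) (b := b) (by positivity)
    (by rw [hb]; linarith)).1
  have hb1 : b - (s + c) = 1 := by rw [hb]; ring
  rw [hb1, mul_one] at hdiff
  have e1 : b ^ (-p) = b ^ (-p - 1) * b := by
    rw [← Real.rpow_add_one hb0.ne']; congr 1; ring
  have e3 : b ^ (-p - 3) * b ^ 2 = b ^ (-p - 1) := by
    rw [← Real.rpow_natCast, ← Real.rpow_add hb0]; congr 1; push_cast; ring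
  have hq : 0 < b ^ (-p - 1) := by positivity
  have hK0 : 0 ≤ K := by positivity
  have e4 : K * b ^ (-p - 3) * (16 * (s * s)) ≤ 16 * K * b ^ (-p - 1) := by
    have : s * s ≤ b ^ 2 := by rw [hb]; nlinarith
    calc K * b ^ (-p - 3) * (16 * (s * s)) ≤ K * b ^ (-p - 3) * (16 * b ^ 2) := by gcongr
      _ = 16 * K * (b ^ (-p - 3) * b ^ 2) := by ring
      _ = _ := by rw [e3]
  unfold avg
  rw [div_le_iff₀ (by positivity)]
  have hpd : 2 * p = d := by rw [hp]; ring
  have e5 : 2 * d * b ^ (-p) ≤ 2 * d * (F (s + c) - F b) := by gcongr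
  -- Since 4p = 2d, the second-order term 2d·s cancels against 2d·b = 2d(s + 1 + c); the surplus
  -- 2d(1 + c) absorbs the remainder because 16K ≤ c.
  have e6 : p * b ^ (-p - 1) * (4 * s) + 16 * K * b ^ (-p - 1) ≤ 2 * d * b ^ (-p) := by
    rw [e1]
    have : p * (4 * s) + 16 * K ≤ 2 * d * b := by
      rw [← hpd, hb]; nlinarith
    nlinarith
  linarith

/-- All neighbours of the origin have squared norm 1, so the drop is `F c - F (1 + c)`. It fixes the
factor by which the barrier must be multiplied to absorb the mass at the origin. -/
lemma avg_barrier_zero_le (hd : 0 < d) {F : ℝ → ℝ}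
    (hF : ∀ b, 0 < b → HasDerivAt F (-b ^ (-(d / 2 : ℝ))) b) {c : ℝ} (hc : 3 ≤ c) :
    avg (fun y => F (sqNorm y + c)) (0 : Fin d → ℤ) + (1 + c) ^ (-(d / 2 : ℝ)) ≤ F c := by
  have h1 : ∀ j : Fin d × Bool, sqNorm (0 + step j) = 1 := by
    intro j
    rw [sqNorm_add_step]
    simp [sqNorm]
  have h2 := (sub_le_of_antideriv (by positivity) hF (a := c) (b := 1 + c) (by positivity)
    (by linarith)).1
  have h3 : avg (fun y => F (sqNorm y + c)) (0 : Fin d → ℤ) = F (1 + c) := by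
    have : (d : ℝ) ≠ 0 := by positivity
    simp only [avg, h1]
    simp
    field_simp
  rw [h3]
  rw [add_sub_cancel_right, mul_one] at h2
  linarith

lemma sq_rpow_neg_half {r : ℝ} (hr : 0 < r) : (r ^ 2) ^ (-(d / 2 : ℝ)) = (r ^ d)⁻¹ := by
  rw [← Real.rpow_natCast r 2, ← Real.rpow_mul hr.le, ← Real.rpow_natCast r d,
    ← Real.rpow_neg hr.le]
  congr 1
  push_cast
  ring

/-- A point outside a ball around the origin has a neighbour that is not adjacent to the ball. -/
lemma exists_neighbour_far (hd : 0 < d) {S : ℝ} (hS : 0 < S) {x : Fin d → ℤ} (hx : S ≤ sqNorm x) :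
    ∃ y, Neighbour y x ∧ y ≠ 0 ∧ ∀ z, Neighbour z y → S ≤ sqNorm z := by
  have : Nonempty (Fin d) := ⟨⟨0, hd⟩⟩
  -- Moving outward along a largest coordinate gains 2|xᵢ| + 1 in squared norm, and any next step
  -- loses at most that much.
  obtain ⟨i, hi⟩ := Finite.exists_max fun i => |x i|
  have hxi : x i ≠ 0 := by
    intro h0
    have : ∀ k, x k = 0 := fun k => by
      have := hi k
      rw [h0, abs_zero] at this
      exact abs_nonpos_iff.1 this
    simp only [sqNorm, this] at hx
    simp at hx
    linarith
  obtain ⟨b, hb⟩ : ∃ b : Bool, stepSign (i, b) * (x i : ℝ) = |(x i : ℝ)| := by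
    rcases abs_choice (x i : ℝ) with h | h
    · exact ⟨true, by simp [stepSign, h]⟩
    · exact ⟨false, by simp [stepSign, h]⟩
  have habs : (1 : ℝ) ≤ |(x i : ℝ)| := by
    exact_mod_cast Int.one_le_abs hxi
  have hy := sqNorm_add_step x (i, b)
  refine ⟨x + step (i, b), neighbour_step _ _, ?_, fun z hz => ?_⟩
  · intro h0
    rw [h0, mul_assoc, hb] at hy
    simp [sqNorm] at hy
    have := sqNorm_nonneg x
    simp only [sqNorm] at this
    linarith
  · obtain ⟨⟨k, b'⟩, rfl⟩ := neighbour_iff.1 hz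
    rw [sqNorm_add_step, hy, mul_assoc 2, hb, mul_assoc 2]
    suffices h : -(1 + |(x i : ℝ)|) ≤ stepSign (k, b') * ((x + step (i, b)) k : ℤ) by linarith
    by_cases hk : k = i
    · subst hk
      have h1 : |(((x + step (k, b)) k : ℤ) : ℝ)| ≤ |(x k : ℝ)| + 1 := by
        have : (((x + step (k, b)) k : ℤ) : ℝ) = x k + stepSign (k, b) := by
          cases b <;> simp [step, stepSign]
        rw [this]
        refine (abs_add_le _ _).trans ?_
        cases b <;> simp [stepSign]
      have := abs_le.1 h1
      cases b' <;> simp only [stepSign, cond_true, cond_false] <;> linarith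
    · have h1 : |(((x + step (i, b)) k : ℤ) : ℝ)| ≤ |(x i : ℝ)| := by
        have : (x + step (i, b)) k = x k := by simp [step, hk]
        rw [this]
        exact_mod_cast hi k
      have := abs_le.1 h1
      cases b' <;> simp only [stepSign, cond_true, cond_false] <;> linarith

/-- A stabilizing function for the point mass `n δ₀`, with a bound for its values. -/
theorem exists_stable_pointMass (hd : 2 ≤ d) :
    ∃ C : ℝ, 0 < C ∧ ∀ n κ : ℝ, 1 < κ → κ ^ d = n → ∃ w : (Fin d → ℤ) → ℝ,
      Stable (pointMass d n) κ w ∧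
      (∀ x, w x ≤ C * n * κ ^ 2) ∧ ∀ x r, 0 < r → r ≤ euclNorm x → w x ≤ C * n * κ ^ 2 / r ^ d := by
  have hd0 : 0 < d := by omega
  obtain ⟨F, hF⟩ := exists_antideriv_rpow (d / 2 : ℝ)
  have hp0 : (0 : ℝ) ≤ d / 2 := by positivity
  obtain ⟨c, hc, hcK⟩ : ∃ c : ℝ, 3 ≤ c ∧
      16 * ((d / 2 : ℝ) * (d / 2 + 1) * (d / 2 + 2) * 2 ^ (d / 2 + 3 : ℝ) / 12) ≤ c :=
    ⟨max 3 _, le_max_left _ _, le_max_right _ _⟩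
  have hc0 : 0 < c := by linarith
  set A : ℝ := (1 + c) ^ (d / 2 : ℝ) with hA
  have hA1 : 1 ≤ A := Real.one_le_rpow (by linarith) hp0
  -- With this R the barrier in the layer just inside radius Rκ is at most R²/R^d·κ, which is at
  -- most κ because d ≥ 2.
  set R : ℝ := 4 * A * 2 ^ d with hR
  have h2d : (1 : ℝ) ≤ 2 ^ d := one_le_pow₀ (by norm_num)
  have hR4 : 4 ≤ R := by rw [hR]; nlinarith
  refine ⟨A * (4 * R ^ 2), by positivity, fun n κ hκ hn => ?_⟩
  have hn0 : 0 < n := by rw [← hn]; positivity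
  have hRκ : 4 ≤ R * κ := by nlinarith
  set S := (R * κ) ^ 2 with hS
  set S' := (R * κ + 1) ^ 2 with hS'
  have hS0 : 0 < S := by positivity
  have hSS' : S < S' := by rw [hS, hS']; nlinarith
  have hS'4 : S' ≤ 4 * R ^ 2 * κ ^ 2 := by rw [hS']; nlinarith
  -- The barrier is normalized to vanish at radius Rκ + 1 but cut off at Rκ. It is thus positive at
  -- all neighbours of the ball, and truncation only lowers the average there.
  set g : (Fin d → ℤ) → ℝ := fun x => A * n * (F (sqNorm x + c) - F (S' + c)) with hg
  set w : (Fin d → ℤ) → ℝ := fun x => if sqNorm x < S then g x else 0 with hw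
  have hgpos : ∀ x : Fin d → ℤ, sqNorm x < S' → 0 < g x := by
    intro x hx
    have h0 := sqNorm_nonneg x
    have h1 := (sub_le_of_antideriv hp0 hF (a := sqNorm x + c) (b := S' + c) (by positivity)
      (by linarith)).1
    have h2 : 0 < (S' + c) ^ (-(d / 2 : ℝ)) * (S' + c - (sqNorm x + c)) := by
      have : 0 < S' + c - (sqNorm x + c) := by linarith
      positivity
    have h3 := h2.trans_le h1
    simp only [hg]
    positivity
  have hgle : ∀ x, sqNorm x < S' →
      g x ≤ A * n * ((sqNorm x + c) ^ (-(d / 2 : ℝ)) * (S' - sqNorm x)) := by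
    intro x hx
    have h0 := sqNorm_nonneg x
    have h1 := (sub_le_of_antideriv hp0 hF (a := sqNorm x + c) (b := S' + c) (by positivity)
      (by linarith)).2
    rw [add_sub_add_right_eq_sub] at h1
    simp only [hg]
    gcongr
  have hwpos : ∀ x, sqNorm x < S → 0 < w x := fun x hx => by
    simp only [hw, if_pos hx]
    exact hgpos x (hx.trans hSS')
  have hwzero : ∀ x, S ≤ sqNorm x → w x = 0 := fun x hx => if_neg (not_lt.2 hx)
  have hw0 : ∀ x, 0 ≤ w x := by
    intro x
    by_cases hx : sqNorm x < S
    · exact (hwpos x hx).le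
    · exact (hwzero x (not_lt.1 hx)).ge
  have hwball : ∀ x, 0 < w x → sqNorm x < S := by
    intro x hx
    by_contra h
    rw [hwzero x (not_lt.1 h)] at hx
    exact lt_irrefl _ hx
  have hnorm : ∀ x : Fin d → ℤ, sqNorm x < S ↔ euclNorm x < R * κ := by
    intro x
    rw [← euclNorm_sq, hS, sq_lt_sq₀ (euclNorm_nonneg x) (by positivity)]
  have hnbr : ∀ x : Fin d → ℤ, sqNorm x < S → ∀ j, sqNorm (x + step j) < S' := by
    intro x hx j
    have h1 := (hnorm x).1 hx
    have h2 := euclNorm_add_le x (step j)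
    rw [euclNorm_step] at h2
    rw [← euclNorm_sq, hS', sq_lt_sq₀ (euclNorm_nonneg _) (by positivity)]
    linarith
  have hwg : ∀ x, sqNorm x < S' → w x ≤ g x := by
    intro x hx
    simp only [hw]
    split_ifs
    · exact le_rfl
    · exact (hgpos x hx).le
  have hmass : ∀ x : Fin d → ℤ, pointMass d n x = if x = 0 then n else 0 := fun x => by
    simp [pointMass, Pi.single_apply]
  have h00 : sqNorm (0 : Fin d → ℤ) = 0 := by simp [sqNorm]
  have hgavg : ∀ x, avg g x = A * n * (avg (fun y => F (sqNorm y + c)) x - F (S' + c)) := by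
    intro x
    have : (d : ℝ) ≠ 0 := by positivity
    simp only [avg, hg]
    rw [← Finset.mul_sum, Finset.sum_sub_distrib]
    simp
    field_simp
  have hsuper : ∀ x, sqNorm x < S → pointMass d n x + avg w x ≤ w x := by
    intro x hx
    have h1 : avg w x ≤ avg g x := by
      unfold avg
      gcongr with j
      exact hwg _ (hnbr x hx j)
    have h2 : w x = g x := if_pos hx
    rw [h2, hmass]
    refine (add_le_add le_rfl h1).trans ?_
    rw [hgavg]
    simp only [hg]
    have hAn : 0 ≤ A * n := by positivity
    split_ifs with h
    · subst h
      have h3 := avg_barrier_zero_le hd0 hF hc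
      have h4 : A * n * (1 + c) ^ (-(d / 2 : ℝ)) = n := by
        rw [hA, Real.rpow_neg (by positivity)]
        have : (1 + c) ^ (d / 2 : ℝ) ≠ 0 := by positivity
        field_simp
      have h5 := mul_le_mul_of_nonneg_left h3 hAn
      rw [h00, zero_add]
      linarith
    · have h3 := mul_le_mul_of_nonneg_left (avg_barrier_le hd0 hF hc hcK x) hAn
      linarith
  -- Superharmonicity is known only inside the ball, and this is enough: a site outside it has a
  -- neighbour that is never reached.
  have hinterior : ∀ x ∈ interior (reach (pointMass d n) w), sqNorm x < S := by
    intro x hx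
    by_contra h
    obtain ⟨y, hyx, hy0, hy⟩ := exists_neighbour_far hd0 hS0 (not_lt.1 h)
    rw [mem_interior_iff] at hx
    rcases hx.2 y hyx with h1 | ⟨z, hz, hz'⟩
    · rw [Function.mem_support, hmass, if_neg hy0] at h1
      exact h1 rfl
    · exact (not_lt.2 (hy z hz.symm)) (hwball z hz')
  have hall : ∀ x, w x ≤ A * n * ((sqNorm x + c) ^ (-(d / 2 : ℝ)) * (4 * R ^ 2 * κ ^ 2)) := by
    intro x
    have h0 := sqNorm_nonneg x
    by_cases hx : sqNorm x < S
    · refine ((hwg x (hx.trans hSS')).trans (hgle x (hx.trans hSS'))).trans ?_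
      gcongr
      linarith
    · rw [hwzero x (not_lt.1 hx)]
      positivity
  refine ⟨w, ⟨hw0, fun x hx => ?_, fun x hx => hsuper x (hinterior x hx), fun x hx => ?_⟩,
    fun x => ?_, fun x r hr hx => ?_⟩
  · by_cases h : x = 0
    · left
      rw [Function.mem_support, hmass, if_pos h]
      exact hn0.ne'
    · right
      have : Nonempty (Fin d) := ⟨⟨0, hd0⟩⟩
      obtain ⟨i, hi⟩ : ∃ i, x i ≠ 0 := by
        by_contra! hcon
        exact h (funext hcon)
      obtain ⟨b, hb⟩ : ∃ b : Bool, stepSign (i, b) * (x i : ℝ) = -|(x i : ℝ)| := by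
        rcases abs_choice (x i : ℝ) with h | h
        · exact ⟨false, by simp [stepSign, h]⟩
        · exact ⟨true, by simp [stepSign, h]⟩
      have habs : (1 : ℝ) ≤ |(x i : ℝ)| := by
        exact_mod_cast Int.one_le_abs hi
      refine ⟨x + step (i, b), (neighbour_step _ _).symm, hwpos _ ?_⟩
      rw [sqNorm_add_step, mul_assoc, hb]
      linarith [hwball x hx]
  · by_cases h : sqNorm x < S
    · linarith [hsuper x h]
    · have hS1 := not_lt.1 h
      have hx0 : x ≠ 0 := by
        rintro rfl
        rw [h00] at hS1
        linarith
      rw [hmass, if_neg hx0, hwzero x hS1, zero_add, add_zero]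
      have hj : ∀ j, w (x + step j) ≤ κ := by
        intro j
        by_cases hy : sqNorm (x + step j) < S
        swap
        · rw [hwzero _ (not_lt.1 hy)]
          linarith
        set y := x + step j with hyd
        have h1 : R * κ ≤ euclNorm x := not_lt.1 fun h' => h ((hnorm x).2 h')
        have h2 : R * κ - 1 ≤ euclNorm y := by
          have h3 := euclNorm_add_le y (-step j)
          rw [euclNorm_neg, euclNorm_step, hyd, add_neg_cancel_right] at h3
          linarith
        have h3 : R * κ / 2 ≤ R * κ - 1 := by linarith
        have h4 : (R * κ - 1) ^ 2 ≤ sqNorm y := by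
          rw [← euclNorm_sq]
          have : 0 ≤ R * κ - 1 := by linarith
          gcongr
        have h5 : (R * κ / 2) ^ 2 ≤ sqNorm y + c := by nlinarith
        have h6 : (sqNorm y + c) ^ (-(d / 2 : ℝ)) ≤ ((R * κ / 2) ^ d)⁻¹ := by
          rw [← sq_rpow_neg_half (by positivity)]
          exact Real.rpow_le_rpow_of_nonpos (by positivity) h5 (by linarith)
        have h7 : S' - sqNorm y ≤ 4 * (R * κ) := by
          rw [hS']; nlinarith
        have h8 : 0 ≤ S' - sqNorm y := by linarith
        calc w y ≤ g y := hwg y (hy.trans hSS')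
          _ ≤ A * n * ((sqNorm y + c) ^ (-(d / 2 : ℝ)) * (S' - sqNorm y)) := hgle y (hy.trans hSS')
          _ ≤ A * n * (((R * κ / 2) ^ d)⁻¹ * (4 * (R * κ))) := by gcongr
          _ = R ^ 2 / R ^ d * κ := by
            rw [div_pow, mul_pow, ← hn, hR]
            field_simp
          _ ≤ 1 * κ := by
            gcongr
            rw [div_le_one (by positivity)]
            exact pow_le_pow_right₀ (by linarith) hd
          _ = κ := one_mul κ
      unfold avg
      rw [div_le_iff₀ (by positivity)]
      refine (Finset.sum_le_sum fun j _ => hj j).trans_eq ?_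
      simp
      ring
  · refine (hall x).trans ?_
    have h0 := sqNorm_nonneg x
    have h1 : (sqNorm x + c) ^ (-(d / 2 : ℝ)) ≤ 1 :=
      Real.rpow_le_one_of_one_le_of_nonpos (by linarith) (by linarith)
    calc _ ≤ A * n * (1 * (4 * R ^ 2 * κ ^ 2)) := by gcongr
      _ = _ := by ring
  · refine (hall x).trans ?_
    have h1 : (sqNorm x + c) ^ (-(d / 2 : ℝ)) ≤ (r ^ d)⁻¹ := by
      rw [← sq_rpow_neg_half hr]
      refine Real.rpow_le_rpow_of_nonpos (by positivity) ?_ (by linarith)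
      rw [← euclNorm_sq]
      have : r ^ 2 ≤ euclNorm x ^ 2 := by gcongr
      linarith
    calc _ ≤ A * n * ((r ^ d)⁻¹ * (4 * R ^ 2 * κ ^ 2)) := by gcongr
      _ = _ := by ring

end Barrier

/-! ### From the estimates to the Lipschitz bound. -/

variable {d : ℕ}

lemma one_le_euclNorm {x : Fin d → ℤ} (hx : x ≠ 0) : 1 ≤ euclNorm x := by
  obtain ⟨i, hi⟩ : ∃ i, x i ≠ 0 := by
    by_contra! hcon
    exact hx (funext hcon)
  refine le_trans ?_ (abs_le_euclNorm x i)
  exact_mod_cast Int.one_le_abs hi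

lemma abs_sub_le_of_nonneg_of_le {a b M : ℝ} (ha : 0 ≤ a) (hb : 0 ≤ b) (ha' : a ≤ M)
    (hb' : b ≤ M) : |a - b| ≤ M :=
  abs_sub_le_iff.2 ⟨by linarith, by linarith⟩

/-- A nonnegative solution of the discrete free boundary problem with the bounds of
`exists_stable_pointMass` is Lipschitz away from the origin. -/
theorem exists_lipschitz_constant (hd : 0 < d) {r₀ C₀ : ℝ} (hr₀ : 0 < r₀) (hC₀ : 0 < C₀) :
    ∃ C : ℝ, ∀ κ : ℝ, 1 < κ → ∀ u : (Fin d → ℤ) → ℝ, (∀ x, 0 ≤ u x) →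
      (∀ x, x ≠ 0 → 0 < u x → u x = avg u x) → (∀ x, u x = 0 → avg u x ≤ κ) →
      (∀ x, u x ≤ C₀ * κ ^ d * κ ^ 2) →
      (∀ x r, 0 < r → r ≤ euclNorm x → u x ≤ C₀ * κ ^ d * κ ^ 2 / r ^ d) →
      ∀ x y, r₀ * κ < euclNorm x → r₀ * κ < euclNorm y →
        |u x - u y| ≤ C * κ * euclNorm (x - y) := by
  set m : ℝ := C₀ * (8 / r₀) ^ d with hm
  set G : ℝ := √((2 * d) ^ 2 + (188 * d + 63) * m ^ 2 * 64 / r₀ ^ 2) with hG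
  have hm0 : 0 < m := by positivity
  -- One summand for each regime: bounded κ, distant points, and nearby points.
  refine ⟨m * (8 / r₀) + m * (2 / r₀) + d * G,
    fun κ hκ u hu hharm hzero hbound hdecay x y hx hy => ?_⟩
  have hκ0 : 0 < κ := by linarith
  have hxy0 := euclNorm_nonneg (x - y)
  have hG0 : 0 ≤ G := Real.sqrt_nonneg _
  have ht1 : 0 ≤ m * (8 / r₀) * κ * euclNorm (x - y) := by positivity
  have ht2 : 0 ≤ m * (2 / r₀) * κ * euclNorm (x - y) := by positivity
  have ht3 : 0 ≤ d * G * κ * euclNorm (x - y) := by positivity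
  have hsplit : (m * (8 / r₀) + m * (2 / r₀) + d * G) * κ * euclNorm (x - y) =
      m * (8 / r₀) * κ * euclNorm (x - y) + m * (2 / r₀) * κ * euclNorm (x - y) +
        d * G * κ * euclNorm (x - y) := by ring
  rw [hsplit]
  -- The points `x`, `y` have norm above 8ρ, a ball of radius 4ρ about `y` stays at norm at least
  -- 4ρ, and a ball of radius 3ρ about any of its points at norm at least ρ.
  set ρ := r₀ * κ / 8 with hρ
  have hρ0 : 0 < ρ := by positivity
  -- If ρ < 1 then κ is bounded, and the global bound on u suffices because distinct lattice points
  -- are at distance at least 1.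
  rcases lt_or_ge ρ 1 with hρ1 | hρ1
  · rcases eq_or_ne x y with rfl | hne
    · rw [sub_self, abs_zero]
      linarith
    have h1 := one_le_euclNorm (sub_ne_zero.2 hne)
    have hκ8 : κ ≤ 8 / r₀ := by
      rw [le_div_iff₀ hr₀]
      linarith
    have h2 : C₀ * κ ^ d * κ ^ 2 ≤ m * (8 / r₀) * κ * euclNorm (x - y) :=
      calc C₀ * κ ^ d * κ ^ 2 = C₀ * κ ^ d * κ * κ * 1 := by ring
        _ ≤ C₀ * (8 / r₀) ^ d * (8 / r₀) * κ * euclNorm (x - y) := by gcongr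
    have h3 := abs_sub_le_of_nonneg_of_le (hu x) (hu y) (hbound x) (hbound y)
    linarith
  have hM : ∀ z, ρ ≤ euclNorm z → u z ≤ m * κ ^ 2 := by
    intro z hz
    refine (hdecay z ρ hρ0 hz).trans_eq ?_
    rw [hm, hρ, div_pow, div_pow, mul_pow]
    field_simp
  rcases lt_or_ge (4 * ρ) (euclNorm (x - y)) with hfar | hnear
  · have h1 := abs_sub_le_of_nonneg_of_le (hu x) (hu y) (hM x (by linarith)) (hM y (by linarith))
    have h2 : m * κ ^ 2 ≤ m * (2 / r₀) * κ * euclNorm (x - y) :=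
      calc m * κ ^ 2 = m * (2 / r₀) * κ * (4 * ρ) := by rw [hρ]; field_simp; norm_num
        _ ≤ _ := by gcongr
    linarith
  · have hgrad : ∀ z j, euclNorm (z - y) ≤ 4 * ρ → |u (z + step j) - u z| ≤ G * κ := by
      intro z j hz
      have hz4 : 4 * ρ ≤ euclNorm z := by
        have := euclNorm_add_le z (y - z)
        rw [add_sub_cancel, euclNorm_sub_comm] at this
        linarith
      have hball : ∀ p, euclNorm (p - z) ≤ 3 * ρ → ρ ≤ euclNorm p := by
        intro p hp
        have := euclNorm_add_le p (z - p)
        rw [add_sub_cancel, euclNorm_sub_comm] at this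
        linarith
      have h1 := sq_step_sub_le hd hu hρ1 (fun p hp => hM p (hball p hp))
        (fun p hp hpos => hharm p (fun h0 => by
          have := hball p hp
          rw [h0, euclNorm_eq] at this
          simp [sqNorm] at this
          linarith) hpos) hzero j
      have h2 : (2 * d * κ) ^ 2 + (188 * d + 63) * (m * κ ^ 2) ^ 2 / ρ ^ 2 = (G * κ) ^ 2 := by
        rw [mul_pow G, hG, Real.sq_sqrt (by positivity), hρ]
        field_simp
        ring
      rw [h2] at h1
      exact abs_le_of_sq_le_sq h1 (by positivity)
    have h1 := abs_sub_le_of_step (by positivity) hgrad hnear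
    have h2 : d * (G * κ) * euclNorm (x - y) = d * G * κ * euclNorm (x - y) := by ring
    linarith

end BoundarySandpile

theorem proposition5p2 (d : ℕ) (hd : 2 ≤ d) (r₀ : ℝ) (hr₀ : 0 < r₀) :
    ∃ C : ℝ, ∀ n : ℝ, 1 < n →
      ∃ u : (Fin d → ℤ) → ℝ,
        BoundarySandpile.IsOdometer
          (BoundarySandpile.pointMass d n) (n ^ (1 / (d : ℝ))) u ∧
        ∀ x y : Fin d → ℤ,
          r₀ * n ^ (1 / (d : ℝ)) < BoundarySandpile.euclNorm x →
          r₀ * n ^ (1 / (d : ℝ)) < BoundarySandpile.euclNorm y →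
          |u x - u y| ≤ C * n ^ (1 / (d : ℝ)) * BoundarySandpile.euclNorm (x - y) := by
  open BoundarySandpile in
  have hd0 : 0 < d := by omega
  obtain ⟨C₀, hC₀, hstable⟩ := exists_stable_pointMass hd
  obtain ⟨C, hC⟩ := exists_lipschitz_constant hd0 hr₀ hC₀
  refine ⟨C, fun n hn => ?_⟩
  have hκ : 1 < n ^ (1 / (d : ℝ)) := Real.one_lt_rpow hn (by positivity)
  have hκn : (n ^ (1 / (d : ℝ))) ^ d = n := by
    rw [one_div, Real.rpow_inv_natCast_pow (by linarith) (by omega)]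
  set κ := n ^ (1 / (d : ℝ))
  obtain ⟨w, hw, hbound, hdecay⟩ := hstable n κ hκ hκn
  have hμ : ∀ x, 0 ≤ pointMass d n x := fun x => by
    simp only [pointMass, Pi.single_apply]
    split_ifs <;> linarith
  obtain ⟨u, hodo, hu, huw, hharm, hzero⟩ := exists_isOdometer (by linarith) hμ hw
  refine ⟨u, hodo, hC κ hκ u hu (fun x hx hpos => ?_) hzero (fun x => ?_) fun x r hr hx => ?_⟩
  · simpa [pointMass, hx] using hharm x hpos
  · rw [hκn]
    exact (huw x).trans (hbound x)
  · rw [hκn]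
    exact (huw x).trans (hdecay x r hr hx)
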